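/- Let $M$ be a compact $n$-dimensional manifold without boundary of class $C^3$, let $\tau>0$, $k\in\mathbb N$, $k\ge 1$, $T=k\tau$ and $S_T=\mathbb R/T\mathbb Z$. Let $L:\mathbb R\times TM\to\mathbb R$ be of class $C^2$, $\tau$-periodic in $t$, with positive definite second derivatives along the fibres of $TM$. Let $\gamma_0\in C^1(S_T,M)$ be a critical point of $\mathcal L_T(\gamma)=\int_0^{T}L(t,\gamma,\dot\gamma)\,dt$ on $C^1(S_T,M)$. Let $B_\rho^n(0)$ be the ball of radius $\rho>0$ in $\mathbb R^n$ and let $\phi:\mathbb R\times B^n_\rho(0)\to M$ be coordinates along $\gamma_0$: $\phi(t+T,q)=\phi(t,q)$, $\phi(t,0)=\gamma_0(t)$, each $\phi(t,\cdot)$ is an injective immersion, and, in local coordinates of $M$, $\phi$ is $C^3$ in $q$, differentiable in $t$, and $\partial_t\phi$ is $C^2$ in $q$, all these derivatives being continuous in $(t,q)$ (for example $\phi(t,q)=\exp_{\gamma_0(t)}\bigl(\sum_i q_ie_i(t)\bigr)$ for a $T$-periodic $C^2$ frame $(e_i)$ along $\gamma_0\in C^2$ and a smooth Riemannian metric). Put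 $$\tilde L(t,q,v)=L\bigl(t,\phi(t,q),\partial_t\phi(t,q)+D_q\phi(t,q)v\bigr),\qquad \tilde{\mathcal L}_T(\xi)=\int_0^{T}\tilde L(t,\xi(t),\dot\xi(t))\,dt$$ for $\xi\in C^1(S_T,B^n_\rho(0))$, an open neighbourhood of $0$ in the Banach space $C^1(S_T,\mathbb R^n)$. Equip $W^{1,2}(S_T,\mathbb R^n)$ with the inner product $(\xi,\eta)_{W^{1,2}}=\int_0^T(\xi\cdot\eta+\dot\xi\cdot\dot\eta)\,dt$. Then $\tilde{\mathcal L}_T$ is differentiable near $0$ and twice Fréchet differentiable at $0$, there is exactly one bounded linear operator $B=B_{T}(0)$ on $W^{1,2}(S_T,\mathbb R^n)$ with $$d^2\tilde{\mathcal L}_T(0)(\xi,\eta)=(B\xi,\eta)_{W^{1,2}}\qquad\text{for all }\xi,\eta\in C^1(S_T,\mathbb R^n),$$ and $B$ is self-adjoint. Moreover: (CP1) $0$ is a critical point of $\tilde{\mathcal L}_T$, and either $0\notin\sigma(B)$ or $0$ is an isolated point of $\sigma(B)$. (CP2) If $\xi\in W^{1,2}(S_T,\mathbb R^n)$ and $B\xi\in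 C^1(S_T,\mathbb R^n)$, then $\xi\in C^1(S_T,\mathbb R^n)$. Finally, there is exactly one closed $B$-invariant subspace $H^-$ of $W^{1,2}(S_T,\mathbb R^n)$ such that $(B\xi,\xi)_{W^{1,2}}<0$ for $0\ne\xi\in H^-$ and $(B\xi,\xi)_{W^{1,2}}\ge 0$ for $\xi\perp H^-$ (the spectral subspace of $B$ for $(-\infty,0)$). It is finite-dimensional and contained in $C^1(S_T,\mathbb R^n)$, and every linear subspace of $W^{1,2}(S_T,\mathbb R^n)$ on which $\xi\mapsto(B\xi,\xi)_{W^{1,2}}$ is negative definite has dimension at most $\dim H^-$. -/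

import Mathlib

open Set Filter Topology MeasureTheory Function
open scoped Manifold ContDiff BoundedContinuousFunction

noncomputable section

namespace Loop

/-- `ℝⁿ` with its Euclidean inner product. -/
abbrev Eu (n : ℕ) : Type := EuclideanSpace ℝ (Fin n)

/-! ### The Banach space `C¹(S_T, ℝⁿ)` -/

/-- `C¹(S_T, ℝⁿ)`, `S_T = ℝ / Tℤ`: pairs `(ξ, ξ')` of bounded continuous functions on the line with
`ξ` of period `T` and `ξ'` the derivative of `ξ`. It carries the norm
`max (sup ‖ξ‖) (sup ‖ξ'‖)`. -/
def C1 (T : ℝ) (n : ℕ) : Submodule ℝ ((ℝ →ᵇ Eu n) × (ℝ →ᵇ Eu n)) where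
  carrier := {p | Periodic p.1 T ∧ ∀ t, HasDerivAt p.1 (p.2 t) t}
  zero_mem' := ⟨fun _ => rfl, fun t => hasDerivAt_const t (0 : Eu n)⟩
  add_mem' {a b} ha hb :=
    ⟨fun t => by simp [ha.1 t, hb.1 t], fun t => (ha.2 t).add (hb.2 t)⟩
  smul_mem' c a ha :=
    ⟨fun t => by simp [ha.1 t], fun t => (ha.2 t).const_smul c⟩

instance (T : ℝ) (n : ℕ) : NormedAddCommGroup (C1 T n) := Submodule.normedAddCommGroup _

instance (T : ℝ) (n : ℕ) : NormedSpace ℝ (C1 T n) := Submodule.normedSpace _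

/-! ### The Hilbert space `W^{1,2}(S_T, ℝⁿ)` -/

/-- Lebesgue measure on a period `(0, T]`. -/
abbrev perMeas (T : ℝ) : Measure ℝ := volume.restrict (Ioc 0 T)

/-- `L²(S_T, ℝⁿ)`. -/
abbrev L2 (T : ℝ) (n : ℕ) : Type := Lp (Eu n) 2 (perMeas T)

theorem memLp_of_continuous {T : ℝ} {n : ℕ} {f : ℝ → Eu n} (hf : Continuous f) :
    MemLp f 2 (perMeas T) := by
  obtain ⟨C, hC⟩ := (isCompact_Icc (a := (0 : ℝ)) (b := T)).exists_bound_of_continuousOn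
    hf.continuousOn
  refine MemLp.of_bound hf.aestronglyMeasurable C ?_
  filter_upwards [ae_restrict_mem measurableSet_Ioc] with t ht
  exact hC t (Ioc_subset_Icc_self ht)

theorem inner_toLp {T : ℝ} {n : ℕ} (u : L2 T n) {f : ℝ → Eu n} (hf : Continuous f) :
    inner ℝ u (memLp_of_continuous (T := T) hf).toLp = ∫ t, inner ℝ (u t) (f t) ∂(perMeas T) := by
  rw [MeasureTheory.L2.inner_def]
  refine integral_congr_ae ?_
  filter_upwards [(memLp_of_continuous (T := T) hf).coeFn_toLp] with t ht
  rw [ht]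

/-- `w` is the weak derivative of `u` on the circle `S_T`, tested against the smooth functions
of period `T`. -/
def IsWeakDeriv {T : ℝ} {n : ℕ} (u w : L2 T n) : Prop :=
  ∀ ψ : ℝ → Eu n, ContDiff ℝ ∞ ψ → Periodic ψ T →
    ∫ t, inner ℝ (u t) (deriv ψ t) ∂(perMeas T) = -∫ t, inner ℝ (w t) (ψ t) ∂(perMeas T)

theorem isWeakDeriv_iff {T : ℝ} {n : ℕ} (u w : L2 T n) :
    IsWeakDeriv u w ↔ ∀ (ψ : ℝ → Eu n) (h : ContDiff ℝ ∞ ψ), Periodic ψ T →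
      inner ℝ u (memLp_of_continuous (T := T) (h.continuous_deriv (by simp))).toLp
        + inner ℝ w (memLp_of_continuous (T := T) h.continuous).toLp = 0 := by
  unfold IsWeakDeriv
  refine forall_congr' fun ψ => forall_congr' fun h => forall_congr' fun _ => ?_
  rw [inner_toLp u (h.continuous_deriv (by simp)), inner_toLp w h.continuous,
    ← eq_neg_iff_add_eq_zero]

/-- `W^{1,2}(S_T, ℝⁿ)`: pairs `(ξ, ξ')` in `L²` with `ξ'` the weak derivative of `ξ`. The inner
product is `∫₀ᵀ (ξ · η + ξ' · η') dt`. -/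
def W12 (T : ℝ) (n : ℕ) : Submodule ℝ (WithLp 2 (L2 T n × L2 T n)) where
  carrier := {p | IsWeakDeriv p.fst p.snd}
  zero_mem' := by
    simp only [mem_ofPred_eq, isWeakDeriv_iff]
    intros
    simp
  add_mem' {a b} ha hb := by
    simp only [mem_ofPred_eq, isWeakDeriv_iff] at *
    intro ψ h hp
    have h1 := ha ψ h hp
    have h2 := hb ψ h hp
    simp only [WithLp.add_fst, WithLp.add_snd, inner_add_left]
    linarith
  smul_mem' c a ha := by
    simp only [mem_ofPred_eq, isWeakDeriv_iff] at *
    intro ψ h hp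
    have h1 := ha ψ h hp
    simp only [WithLp.smul_fst, WithLp.smul_snd, real_inner_smul_left]
    rw [← mul_add, h1, mul_zero]

theorem isClosed_W12 (T : ℝ) (n : ℕ) : IsClosed (W12 T n : Set (WithLp 2 (L2 T n × L2 T n))) := by
  have : (W12 T n : Set (WithLp 2 (L2 T n × L2 T n))) =
      {p | ∀ (ψ : ℝ → Eu n) (h : ContDiff ℝ ∞ ψ), Periodic ψ T →
      inner ℝ p.fst (memLp_of_continuous (T := T) (h.continuous_deriv (by simp))).toLp
        + inner ℝ p.snd (memLp_of_continuous (T := T) h.continuous).toLp = 0} := by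
    ext p
    exact isWeakDeriv_iff p.fst p.snd
  rw [this]
  simp only [ofPred_forall]
  refine isClosed_iInter fun ψ => isClosed_iInter fun h => isClosed_iInter fun _ => ?_
  refine isClosed_eq ?_ continuous_const
  have h1 : Continuous fun p : WithLp 2 (L2 T n × L2 T n) => p.fst :=
    continuous_fst.comp (WithLp.prod_continuous_ofLp 2 _ _)
  have h2 : Continuous fun p : WithLp 2 (L2 T n × L2 T n) => p.snd :=
    continuous_snd.comp (WithLp.prod_continuous_ofLp 2 _ _)
  exact (h1.inner continuous_const).add (h2.inner continuous_const)

instance (T : ℝ) (n : ℕ) : CompleteSpace (W12 T n) :=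
  (isClosed_W12 T n).completeSpace_coe

theorem isWeakDeriv_of_mem_C1 {T : ℝ} {n : ℕ} (p : C1 T n) :
    IsWeakDeriv (T := T) (n := n) (memLp_of_continuous (T := T) p.1.1.continuous).toLp
      (memLp_of_continuous (T := T) p.1.2.continuous).toLp := by
  intro ψ hψ hp
  have e1 : ∫ t, inner ℝ (((memLp_of_continuous (T := T) p.1.1.continuous).toLp : L2 T n) t) (deriv ψ t)
      ∂(perMeas T) = ∫ t, inner ℝ (p.1.1 t) (deriv ψ t) ∂(perMeas T) := by
    refine integral_congr_ae ?_
    filter_upwards [(memLp_of_continuous (T := T) p.1.1.continuous).coeFn_toLp] with t ht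
    rw [ht]
  have e2 : ∫ t, inner ℝ (((memLp_of_continuous (T := T) p.1.2.continuous).toLp : L2 T n) t) (ψ t)
      ∂(perMeas T) = ∫ t, inner ℝ (p.1.2 t) (ψ t) ∂(perMeas T) := by
    refine integral_congr_ae ?_
    filter_upwards [(memLp_of_continuous (T := T) p.1.2.continuous).coeFn_toLp] with t ht
    rw [ht]
  rw [e1, e2]
  rcases le_or_gt T 0 with hT | hT
  · simp [perMeas, Ioc_eq_empty (not_lt.mpr hT)]
  have c1 : Continuous fun t => inner ℝ (p.1.1 t) (deriv ψ t) :=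
    p.1.1.continuous.inner (hψ.continuous_deriv (by simp))
  have c2 : Continuous fun t => inner ℝ (p.1.2 t) (ψ t) :=
    p.1.2.continuous.inner hψ.continuous
  have hd : ∀ t, HasDerivAt (fun t => inner ℝ (p.1.1 t) (ψ t))
      (inner ℝ (p.1.1 t) (deriv ψ t) + inner ℝ (p.1.2 t) (ψ t)) t := fun t =>
    (p.2.2 t).inner ℝ ((hψ.differentiable (by simp)) t).hasDerivAt
  have key := intervalIntegral.integral_eq_sub_of_hasDerivAt (a := 0) (b := T)
    (fun t _ => hd t) ((c1.add c2).intervalIntegrable _ _)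
  have q1 : p.1.1 T = p.1.1 0 := by simpa using p.2.1 0
  have q2 : ψ T = ψ 0 := by simpa using hp 0
  rw [q1, q2, sub_self, intervalIntegral.integral_add (c1.intervalIntegrable _ _)
    (c2.intervalIntegrable _ _), intervalIntegral.integral_of_le hT.le,
    intervalIntegral.integral_of_le hT.le] at key
  linarith

/-- The inclusion `C¹(S_T, ℝⁿ) ⊆ W^{1,2}(S_T, ℝⁿ)`. -/
def incl (T : ℝ) (n : ℕ) : C1 T n →ₗ[ℝ] W12 T n where
  toFun p := ⟨WithLp.toLp 2 ((memLp_of_continuous (T := T) p.1.1.continuous).toLp,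
    (memLp_of_continuous (T := T) p.1.2.continuous).toLp), isWeakDeriv_of_mem_C1 p⟩
  map_add' _ _ := rfl
  map_smul' _ _ := rfl

/-! ### Families of maps into a manifold -/

section Families

variable {E F : Type*} [NormedAddCommGroup E] [NormedSpace ℝ E]
  [NormedAddCommGroup F] [NormedSpace ℝ F]

/-- Near `p`, the maps `h t` are of class `C^r`, and their derivatives of order `≤ r` are continuous
jointly in `t` and the point. -/
def ContDiffSndAt (r : ℕ) (h : ℝ → E → F) (p : ℝ × E) : Prop :=
  ∀ᶠ z in 𝓝 p, ContDiffAt ℝ r (h z.1) z.2 ∧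
    ∀ j ≤ r, ContinuousAt (fun w : ℝ × E => iteratedFDeriv ℝ j (h w.1) w.2) z

variable (n : ℕ) {M : Type*} [TopologicalSpace M] [ChartedSpace (Eu n) M]

/-- `f`, read in the preferred chart of `M` at `f t₀ q₀`. -/
def localRep (f : ℝ → E → M) (t₀ : ℝ) (q₀ : E) : ℝ → E → Eu n :=
  fun t q => extChartAt (𝓡 n) (f t₀ q₀) (f t q)

/-- In local coordinates of `M`, `f t q` (for `q ∈ U`) is of class `C^r` in `q`, it is differentiable
in `t`, and `∂f/∂t` is of class `C^s` in `q`, where all the derivatives in question are continuous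
in `(t, q)`. -/
structure IsFamily (r s : ℕ) (f : ℝ → E → M) (U : Set E) : Prop where
  cont : ContinuousOn (uncurry f) (univ ×ˢ U)
  space : ∀ t, ∀ q ∈ U, ContDiffSndAt r (localRep n f t q) (t, q)
  diff : ∀ t, ∀ q ∈ U, ∀ᶠ z in 𝓝 (t, q),
    DifferentiableAt ℝ (fun t' => localRep n f t q t' z.2) z.1
  time : ∀ t, ∀ q ∈ U,
    ContDiffSndAt s (fun t' x => deriv (fun t'' => localRep n f t q t'' x) t') (t, q)

end Families

/-! ### Lagrangians, critical loops, and the pull-back -/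

section Lagrangian

variable {n : ℕ} {M : Type*} [TopologicalSpace M] [ChartedSpace (Eu n) M] [IsManifold (𝓡 n) 1 M]

/-- `∫₀ᵀ L(t, γ(t), γ'(t)) dt`. -/
def action (T : ℝ) (L : ℝ × TangentBundle (𝓡 n) M → ℝ) (γ : ℝ → M) : ℝ :=
  ∫ t in (0 : ℝ)..T, L (t, ⟨γ t, mfderiv 𝓘(ℝ, ℝ) (𝓡 n) γ t (1 : ℝ)⟩)

/-- `L` has positive definite second derivatives along the fibres of `TM`. -/
def FibrewiseConvex (L : ℝ × TangentBundle (𝓡 n) M → ℝ) : Prop :=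
  ∀ (t : ℝ) (x : M) (v u : TangentSpace (𝓡 n) x), u ≠ 0 →
    0 < iteratedDeriv 2 (fun s : ℝ => L (t, ⟨x, v + s • u⟩)) 0

/-- The loop `γ` of period `T` is a critical point of the action on `C¹(S_T, M)`: the derivative
of the action vanishes along every `C¹` path `s ↦ Γ(·, s)`, `|s| < ε`, of `C¹` loops of period `T`
that passes through `γ` at `s = 0`. -/
def IsCriticalLoop (T : ℝ) (L : ℝ × TangentBundle (𝓡 n) M → ℝ) (γ : ℝ → M) : Prop :=
  Periodic γ T ∧ ContMDiff 𝓘(ℝ, ℝ) (𝓡 n) 1 γ ∧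
    ∀ (ε : ℝ) (Γ : ℝ → ℝ → M), 0 < ε → IsFamily n 1 1 Γ (Metric.ball 0 ε) →
      (∀ t, ∀ s ∈ Metric.ball (0 : ℝ) ε, Γ (t + T) s = Γ t s) → (∀ t, Γ t 0 = γ t) →
      HasDerivAt (fun s => action T L (fun t => Γ t s)) 0 0

/-- `φ`, defined on `ℝ × B_ρ(0)`, is a family of coordinates along the loop `γ`: it has period `T`
in `t`, it maps `(t, 0)` to `γ t`, and each `φ t` is an injective immersion of the ball (a local
parametrization of `M`). The induced map `ξ ↦ (t ↦ φ t (ξ t))` is a chart at `γ` of the manifold of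
loops. The regularity is that of `φ t q = exp_{γ t} (∑ qᵢ eᵢ(t))` for a periodic frame `e`
of class `C²` along a loop `γ` of class `C²`. -/
structure IsLoopChart (T ρ : ℝ) (γ : ℝ → M) (φ : ℝ → Eu n → M) : Prop where
  regular : IsFamily n 3 2 φ (Metric.ball 0 ρ)
  periodic : ∀ t, ∀ q ∈ Metric.ball (0 : Eu n) ρ, φ (t + T) q = φ t q
  center : ∀ t, φ t 0 = γ t
  injOn : ∀ t, InjOn (φ t) (Metric.ball 0 ρ)
  immersion : ∀ t, ∀ q ∈ Metric.ball (0 : Eu n) ρ,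
    Injective (mfderiv 𝓘(ℝ, Eu n) (𝓡 n) (φ t) q)

/-- The pull-back `L̃(t, q, v) = L(t, φ(t, q), ∂ₜφ(t, q) + D_qφ(t, q) v)`. -/
def pullback (L : ℝ × TangentBundle (𝓡 n) M → ℝ) (φ : ℝ → Eu n → M) (t : ℝ) (q v : Eu n) : ℝ :=
  L (t, ⟨φ t q, mfderiv 𝓘(ℝ, ℝ × Eu n) (𝓡 n) (uncurry φ) (t, q) ((1, v) : ℝ × Eu n)⟩)

/-- The pulled-back functional `ξ ↦ ∫₀ᵀ L̃(t, ξ(t), ξ'(t)) dt`; it is meaningful on the open set of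
those `ξ` that take values in `B_ρ(0)`, a neighbourhood of `0`. -/
def pulledAction (T : ℝ) (L : ℝ × TangentBundle (𝓡 n) M → ℝ) (φ : ℝ → Eu n → M)
    (ξ : C1 T n) : ℝ :=
  ∫ t in (0 : ℝ)..T, pullback L φ t (ξ.1.1 t) (ξ.1.2 t)

end Lagrangian

/-! ### The operator of the second variation -/

/-- The functional `f` on `C¹(S_T, ℝⁿ)` is twice (Fréchet) differentiable at `0`, and
`d²f(0)(ξ, η) = (Bξ, η)` in `W^{1,2}`. -/
def RepresentsHessian {T : ℝ} {n : ℕ} (f : C1 T n → ℝ) (B : W12 T n →L[ℝ] W12 T n) : Prop :=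
  (∀ᶠ ξ in 𝓝 (0 : C1 T n), DifferentiableAt ℝ f ξ) ∧
    ∃ D : C1 T n →L[ℝ] C1 T n →L[ℝ] ℝ, HasFDerivAt (fderiv ℝ f) D 0 ∧
      ∀ ξ η : C1 T n, D ξ η = inner ℝ (B (incl T n ξ)) (incl T n η)

/-- `V` is the negative space of `B`: a closed `B`-invariant subspace such that `B` is negative
definite on `V` and nonnegative on the orthogonal complement of `V`. For self-adjoint `B` this is
the spectral subspace of `B` that belongs to `(-∞, 0)`. -/
structure IsNegativeSpace {H : Type*} [NormedAddCommGroup H] [InnerProductSpace ℝ H]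
    (B : H →L[ℝ] H) (V : Submodule ℝ H) : Prop where
  closed : IsClosed (V : Set H)
  invariant : ∀ v ∈ V, B v ∈ V
  neg : ∀ v ∈ V, v ≠ 0 → inner ℝ (B v) v < 0
  nonneg : ∀ w ∈ Vᗮ, 0 ≤ inner ℝ (B w) w

end Loop

end

/-!
In the coordinates, the second variation is `∫ a(t) (ξ, ξ') (η, η') dt`, and fibrewise convexity of
`L` makes the block `P` of `a` that pairs `ξ'` with `η'` uniformly positive. The functions with
mean zero on each of finitely many short intervals form a closed subspace of finite codimension, on
which `‖ξ‖ ≤ h ‖ξ'‖` in `L²` with `h` as small as one likes, so that `P` dominates all other terms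
there. Hence the operator `B` of the form is coercive up to finite codimension. This survives the
subtraction of a small multiple of the identity, so near and below zero the spectrum of `B`
consists of finitely many eigenvalues of finite multiplicity, and `H⁻` is the sum of the negative
eigenspaces.

The equation `B ξ = g` says that `P ξ' + Q ξ - g'` has a weak derivative in `L²`, so it is
continuous; inverting `P` shows that `ξ` is `C¹`. For an eigenvector with eigenvalue `μ < 0`, the
same argument applies with `P - μ` in place of `P`. Uniqueness of `B` is the density of `C¹` in
`W^{1,2}`.
-/

noncomputable section

namespace Loop

section EssentiallyCoercive

variable {H : Type*} [NormedAddCommGroup H] [InnerProductSpace ℝ H]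

/-- The quadratic form of `A` is coercive on a closed subspace of finite codimension; this is the
abstract form of a Gårding inequality with compact error term. The subspace is encoded by its
orthogonal complement `F`. -/
def IsEssentiallyCoercive (A : H →L[ℝ] H) : Prop :=
  ∃ F : Submodule ℝ H, FiniteDimensional ℝ F ∧ ∃ c > 0, ∀ x ∈ Fᗮ, c * ‖x‖ ^ 2 ≤ inner ℝ (A x) x

/-- The span of the eigenvectors of `B` for negative eigenvalues. -/
def negEigenspan (B : H →L[ℝ] H) : Submodule ℝ H :=
  ⨆ μ : Iio (0 : ℝ), Module.End.eigenspace B.toLinearMap μ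

theorem finrank_le_of_neg_of_nonneg {B : H →L[ℝ] H} {V S : Submodule ℝ H}
    [FiniteDimensional ℝ V] (hV : ∀ w ∈ Vᗮ, 0 ≤ inner ℝ (B w) w)
    (hS : ∀ v ∈ S, v ≠ 0 → inner ℝ (B v) v < 0) :
    FiniteDimensional ℝ S ∧ Module.finrank ℝ S ≤ Module.finrank ℝ V := by
  let f : S →ₗ[ℝ] V := V.orthogonalProjectionOnto.toLinearMap ∘ₗ S.subtype
  have hf : Injective f := by
    refine LinearMap.ker_eq_bot.mp (eq_bot_iff.mpr fun x hx => ?_)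
    have hxV : (x : H) ∈ Vᗮ := V.orthogonalProjectionOnto_eq_zero_iff.mp hx
    by_contra hx0
    exact (hS x x.2 (by simpa using hx0)).not_ge (hV x hxV)
  exact ⟨FiniteDimensional.of_injective f hf, LinearMap.finrank_le_finrank_of_injective hf⟩

theorem inner_sub_algebraMap (A : H →L[ℝ] H) (μ : ℝ) (x : H) :
    inner ℝ ((A - algebraMap ℝ (H →L[ℝ] H) μ) x) x = inner ℝ (A x) x - μ * ‖x‖ ^ 2 := by
  rw [← real_inner_self_eq_norm_sq, ← real_inner_smul_left, ← inner_sub_left]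
  rfl

theorem map_mem_orthogonal [CompleteSpace H] {B : H →L[ℝ] H} (hB : IsSelfAdjoint B)
    {V : Submodule ℝ H} (hV : ∀ v ∈ V, B v ∈ V) {w : H} (hw : w ∈ Vᗮ) : B w ∈ Vᗮ := fun v hv =>
  (hB.isSymmetric v w).symm.trans (hw _ (hV v hv))

/-- The number is `‖B‖ - ‖T‖` with `T = ‖B‖ - B ≥ 0`, whose norm is the supremum of its Rayleigh
quotients and lies in its spectrum. -/
theorem exists_mem_spectrum_forall_le [CompleteSpace H] [Nontrivial H] {B : H →L[ℝ] H}
    (hB : IsSelfAdjoint B) : ∃ m ∈ spectrum ℝ B, ∀ x, m * ‖x‖ ^ 2 ≤ inner ℝ (B x) x := by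
  set T : H →L[ℝ] H := algebraMap ℝ (H →L[ℝ] H) ‖B‖ - B with hT
  have hform : ∀ x, inner ℝ (T x) x = ‖B‖ * ‖x‖ ^ 2 - inner ℝ (B x) x := fun x => by
    rw [← neg_sub (inner ℝ (B x) x), ← inner_sub_algebraMap, ← inner_neg_left, hT]
    simp
  have hTsymm : T.IsSymmetric := by
    have hnorm : IsSelfAdjoint (algebraMap ℝ (H →L[ℝ] H) ‖B‖) :=
      (IsSelfAdjoint.all ‖B‖).algebraMap (H →L[ℝ] H)
    exact (hnorm.sub hB).isSymmetric
  have hTnonneg : ∀ x, 0 ≤ T.rayleighQuotient x := fun x => by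
    refine div_nonneg ?_ (by positivity)
    change 0 ≤ inner ℝ (T x) x
    rw [hform, sub_nonneg, sq, ← mul_assoc]
    exact (real_inner_le_norm _ _).trans (by gcongr; exact B.le_opNorm x)
  have hTspec : ‖T‖ ∈ spectrum ℝ T := by
    by_contra hres
    obtain ⟨ε, hε, hle⟩ := T.rayleighQuotient_le_of_norm_mem_resolventSet (not_not.mp hres)
    have hsup : ‖T‖ ≤ ‖T‖ - ε := by
      nth_rewrite 1 [T.norm_eq_iSup_rayleighQuotient hTsymm]
      exact ciSup_le fun x => by rw [abs_of_nonneg (hTnonneg x)]; exact hle x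
    linarith
  refine ⟨‖B‖ - ‖T‖, ?_, fun x => ?_⟩
  · rw [hT, ← spectrum.singleton_sub_eq, singleton_sub, mem_image] at hTspec
    obtain ⟨m, hm, hmT : ‖B‖ - m = ‖T‖⟩ := hTspec
    rwa [← hmT, sub_sub_cancel]
  · have hle : inner ℝ (T x) x ≤ ‖T‖ * ‖x‖ ^ 2 := by
      rw [sq, ← mul_assoc]
      exact (real_inner_le_norm _ _).trans (by gcongr; exact T.le_opNorm x)
    linarith [hform x]

theorem mem_negEigenspan {B : H →L[ℝ] H} {μ : ℝ} (hμ : μ < 0) {x : H} (hx : B x = μ • x) :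
    x ∈ negEigenspan B :=
  le_iSup (fun μ : Iio (0 : ℝ) => Module.End.eigenspace B.toLinearMap μ) ⟨μ, hμ⟩
    (Module.End.mem_eigenspace_iff.mpr hx)

theorem map_mem_negEigenspan {B : H →L[ℝ] H} {x : H} (hx : x ∈ negEigenspan B) :
    B x ∈ negEigenspan B := by
  refine Submodule.iSup_induction _ (motive := fun x => B x ∈ negEigenspan B) hx
    (fun μ x hx => ?_) (by simp) fun x y hx hy => ?_
  · have hx : B x = (μ : ℝ) • x := Module.End.mem_eigenspace_iff.mp hx
    rw [hx]
    exact Submodule.smul_mem _ _ (mem_negEigenspan μ.2 hx)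
  · rw [map_add]
    exact Submodule.add_mem _ hx hy

theorem inner_neg_of_mem_negEigenspan [CompleteSpace H] {B : H →L[ℝ] H} (hB : IsSelfAdjoint B)
    {x : H} (hx : x ∈ negEigenspan B) (hx0 : x ≠ 0) : inner ℝ (B x) x < 0 := by
  obtain ⟨f, hf, rfl⟩ := (Submodule.mem_iSup_iff_exists_finsupp _ _).mp hx
  have hBf : ∀ μ, B (f μ) = (μ : ℝ) • f μ := fun μ => Module.End.mem_eigenspace_iff.mp (hf μ)
  have horth := (hB.isSymmetric.orthogonalFamily_eigenspaces.comp Subtype.val_injective).inner_sum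
    (fun μ : Iio (0 : ℝ) => (μ : ℝ) • ⟨f μ, hf μ⟩) (fun μ => ⟨f μ, hf μ⟩) f.support
  have hform : inner ℝ (B (f.sum fun _ y => y)) (f.sum fun _ y => y) =
      ∑ μ ∈ f.support, (μ : ℝ) * ‖f μ‖ ^ 2 := by
    calc inner ℝ (B (f.sum fun _ y => y)) (f.sum fun _ y => y)
        = inner ℝ (∑ μ ∈ f.support, (μ : ℝ) • f μ) (∑ μ ∈ f.support, f μ) := by
          simp only [Finsupp.sum, map_sum, hBf]
      _ = ∑ μ ∈ f.support, inner ℝ ((μ : ℝ) • f μ) (f μ) := horth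
      _ = _ := by simp only [real_inner_smul_left, real_inner_self_eq_norm_sq]
  rw [hform]
  refine Finset.sum_neg (fun μ hμ => ?_) (Finset.nonempty_iff_ne_empty.mpr fun h => hx0 ?_)
  · have := norm_pos_iff.mpr (Finsupp.mem_support_iff.mp hμ)
    exact mul_neg_of_neg_of_pos μ.2 (by positivity)
  · simp [Finsupp.sum, h]

namespace IsEssentiallyCoercive

variable {A : H →L[ℝ] H}

theorem exists_forall_sub_smul (hA : IsEssentiallyCoercive A) :
    ∃ c > (0 : ℝ), ∀ μ < c, IsEssentiallyCoercive (A - algebraMap ℝ (H →L[ℝ] H) μ) := by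
  obtain ⟨F, hF, c, hc, hFc⟩ := hA
  refine ⟨c, hc, fun μ hμ => ⟨F, hF, c - μ, sub_pos.mpr hμ, fun x hx => ?_⟩⟩
  rw [inner_sub_algebraMap, sub_mul]
  exact sub_le_sub_right (hFc x hx) _

theorem restrict (hA : IsEssentiallyCoercive A) {W : Submodule ℝ H} [W.HasOrthogonalProjection]
    {A' : W →L[ℝ] W} (hA' : ∀ w : W, (A' w : H) = A w) : IsEssentiallyCoercive A' := by
  obtain ⟨F, hF, c, hc, hFc⟩ := hA
  refine ⟨F.map W.orthogonalProjectionOnto.toLinearMap, inferInstance, c, hc, fun w hw => ?_⟩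
  rw [Submodule.coe_inner, hA']
  refine hFc w fun y hy => ?_
  have horth : inner ℝ (W.orthogonalProjectionOnto y) w = (0 : ℝ) := hw _ ⟨y, hy, rfl⟩
  rwa [Submodule.inner_orthogonalProjectionOnto_eq_of_mem_right] at horth

/-- Young's inequality absorbs the cross terms between `F` and `Fᗮ`. -/
theorem exists_coercive_add (hA : IsEssentiallyCoercive A) :
    ∃ (F : Submodule ℝ H) (_ : FiniteDimensional ℝ F) (C c : ℝ), 0 < c ∧
      ∀ x, c * ‖x‖ ^ 2 ≤ inner ℝ ((A + C • F.starProjection) x) x := by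
  obtain ⟨F, hF, c, hc, hFc⟩ := hA
  refine ⟨F, hF, c / 2 + ‖A‖ + 2 * ‖A‖ ^ 2 / c, c / 2, by positivity, fun x => ?_⟩
  set b := F.starProjection x
  set a := Fᗮ.starProjection x
  have hx : x = b + a := (F.starProjection_add_starProjection_orthogonal x).symm
  have ha : a ∈ Fᗮ := Fᗮ.starProjection_apply_mem x
  have hb : b ∈ F := F.starProjection_apply_mem x
  have hba : inner ℝ b a = (0 : ℝ) := ha b hb
  have hnorm : ‖x‖ ^ 2 = ‖b‖ ^ 2 + ‖a‖ ^ 2 := by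
    rw [hx, norm_add_sq_real, hba]; ring
  have hbound : ∀ y z : H, -(‖A‖ * ‖y‖ * ‖z‖) ≤ inner ℝ (A y) z := fun y z =>
    neg_le_of_abs_le <| (abs_real_inner_le_norm _ _).trans <| by gcongr; exact A.le_opNorm y
  have hform : inner ℝ ((A + (c / 2 + ‖A‖ + 2 * ‖A‖ ^ 2 / c) • F.starProjection) x) x =
      inner ℝ (A a) a + inner ℝ (A a) b + inner ℝ (A b) a + inner ℝ (A b) b
        + (c / 2 + ‖A‖ + 2 * ‖A‖ ^ 2 / c) * ‖b‖ ^ 2 := by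
    change inner ℝ (A x + (c / 2 + ‖A‖ + 2 * ‖A‖ ^ 2 / c) • b) x = _
    rw [inner_add_left, real_inner_smul_left]
    nth_rewrite 3 [hx]
    rw [inner_add_right b, hba, real_inner_self_eq_norm_sq, hx, map_add]
    simp only [inner_add_left, inner_add_right]
    ring
  have hyoung : 2 * (‖A‖ * ‖a‖ * ‖b‖) ≤ c / 2 * ‖a‖ ^ 2 + 2 * ‖A‖ ^ 2 / c * ‖b‖ ^ 2 := by
    have : 0 ≤ (c * ‖a‖ - 2 * ‖A‖ * ‖b‖) ^ 2 / (2 * c) := by positivity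
    calc 2 * (‖A‖ * ‖a‖ * ‖b‖) ≤ 2 * (‖A‖ * ‖a‖ * ‖b‖)
          + (c * ‖a‖ - 2 * ‖A‖ * ‖b‖) ^ 2 / (2 * c) := le_add_of_nonneg_right this
      _ = c / 2 * ‖a‖ ^ 2 + 2 * ‖A‖ ^ 2 / c * ‖b‖ ^ 2 := by field_simp; ring
  rw [hform, hnorm]
  linarith [hFc a ha, hbound a b, hbound b a, hbound b b]

variable [CompleteSpace H]

/-- The Fredholm alternative: `A` is a finite-rank perturbation of a coercive operator, which
is invertible by the Lax–Milgram theorem. -/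
theorem isUnit_of_injective (hA : IsEssentiallyCoercive A) (hinj : ∀ x, A x = 0 → x = 0) :
    IsUnit A := by
  obtain ⟨F, hF, C, c, hc, hcoer⟩ := hA.exists_coercive_add
  have hlm : IsCoercive ((innerSL ℝ).comp (A + C • F.starProjection)) :=
    ⟨c, hc, fun x => by
      rw [mul_assoc, ← sq]
      exact hcoer x⟩
  let G : H ≃L[ℝ] H := hlm.continuousLinearEquivOfBilin
  have hG : ∀ x, G x = A x + C • F.starProjection x := fun x => by
    refine ext_inner_right ℝ fun y => ?_
    exact hlm.continuousLinearEquivOfBilin_apply x y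
  let K : H →L[ℝ] H := (G.symm : H →L[ℝ] H) ∘L (C • F.starProjection)
  have hK : IsCompactOperator K := by
    have hP : IsCompactOperator F.orthogonalProjectionOnto :=
      isCompactOperator_of_locallyCompactSpace_dom _
    exact ((hP.clm_comp F.subtypeL).smul C).clm_comp (G.symm : H →L[ℝ] H)
  have hGK : ∀ x, G (x - K x) = A x := fun x => by
    rw [map_sub, hG]
    simp [K]
  rcases hK.hasEigenvalue_or_mem_resolventSet one_ne_zero with hev | hres
  · obtain ⟨x, hx⟩ := hev.exists_hasEigenvector
    refine absurd (hinj x ?_) hx.2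
    rw [← hGK, show K x = x by simpa using hx.apply_eq_smul, sub_self, map_zero]
  · have hAG : A = (G : H →L[ℝ] H) * (1 - K) := ContinuousLinearMap.ext fun x => (hGK x).symm
    rw [hAG]
    refine IsUnit.mul ⟨ContinuousLinearEquiv.toUnit G, rfl⟩ ?_
    simpa [spectrum.mem_resolventSet_iff] using hres

theorem nonneg_of_forall_eq_smul_imp (hA : IsEssentiallyCoercive A) (hsa : IsSelfAdjoint A)
    (hev : ∀ μ < (0 : ℝ), ∀ x, A x = μ • x → x = 0) (x : H) : 0 ≤ inner ℝ (A x) x := by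
  rcases subsingleton_or_nontrivial H with _ | _
  · simp [Subsingleton.elim x 0]
  obtain ⟨m, hm, hle⟩ := exists_mem_spectrum_forall_le hsa
  have hm0 : 0 ≤ m := by
    by_contra! hm0
    obtain ⟨c, hc, hAc⟩ := hA.exists_forall_sub_smul
    refine spectrum.mem_iff.mp hm (IsUnit.sub_iff.mp ?_)
    exact (hAc m (hm0.trans hc)).isUnit_of_injective fun x hx =>
      hev m hm0 x (sub_eq_zero.mp hx)
  exact (by positivity : 0 ≤ m * ‖x‖ ^ 2).trans (hle x)

theorem finiteDimensional_negEigenspan (hA : IsEssentiallyCoercive A) (hsa : IsSelfAdjoint A) :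
    FiniteDimensional ℝ (negEigenspan A) := by
  obtain ⟨F, hF, c, hc, hFc⟩ := hA
  exact (finrank_le_of_neg_of_nonneg (V := F)
    (fun x hx => (by positivity : 0 ≤ c * ‖x‖ ^ 2).trans (hFc x hx))
    fun x hx hx0 => inner_neg_of_mem_negEigenspan hsa hx hx0).1

theorem isNegativeSpace_negEigenspan (hA : IsEssentiallyCoercive A) (hsa : IsSelfAdjoint A) :
    IsNegativeSpace A (negEigenspan A) where
  closed := by
    have := hA.finiteDimensional_negEigenspan hsa
    exact Submodule.closed_of_finiteDimensional _
  invariant _ hv := map_mem_negEigenspan hv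
  neg _ hv hv0 := inner_neg_of_mem_negEigenspan hsa hv hv0
  nonneg w hw := by
    have hmaps : ∀ v ∈ (negEigenspan A)ᗮ, A v ∈ (negEigenspan A)ᗮ := fun v hv =>
      map_mem_orthogonal hsa (fun _ => map_mem_negEigenspan) hv
    have hsa' : IsSelfAdjoint (A.restrict hmaps) :=
      LinearMap.IsSymmetric.isSelfAdjoint fun x y => hsa.isSymmetric x y
    refine (hA.restrict (A' := A.restrict hmaps) fun _ => rfl).nonneg_of_forall_eq_smul_imp hsa'
      (fun μ hμ x hx => ?_) ⟨w, hw⟩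
    have hxV : (x : H) ∈ negEigenspan A := mem_negEigenspan hμ (congrArg Subtype.val hx)
    exact Subtype.ext (inner_self_eq_zero.mp (x.2 _ hxV))

/-- On the orthogonal complement of the kernel the operator has a bounded inverse `G`, and the
eigenvectors `x` for `μ ≠ 0` lie in that complement, so `x = μ • G x`. -/
theorem exists_forall_abs_lt_eq_smul_imp (hA : IsEssentiallyCoercive A) (hsa : IsSelfAdjoint A) :
    ∃ δ > 0, ∀ μ : ℝ, μ ≠ 0 → |μ| < δ → ∀ x, A x = μ • x → x = 0 := by
  let K : Submodule ℝ H := LinearMap.ker A.toLinearMap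
  obtain ⟨A', hA'⟩ : ∃ A' : Kᗮ →L[ℝ] Kᗮ, ∀ w, (A' w : H) = A w :=
    ⟨A.restrict fun v hv => map_mem_orthogonal hsa
      (fun x (hx : A x = 0) => by rw [hx]; exact K.zero_mem) hv, fun _ => rfl⟩
  obtain ⟨G, hG⟩ : ∃ G : Kᗮ →L[ℝ] Kᗮ, G * A' = 1 := by
    refine IsUnit.exists_left_inv ((hA.restrict hA').isUnit_of_injective fun x hx => ?_)
    have hxK : (x : H) ∈ K := (hA' x).symm.trans (congrArg Subtype.val hx)
    exact Subtype.ext (inner_self_eq_zero.mp (x.2 _ hxK))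
  refine ⟨1 / (‖G‖ + 1), by positivity, fun μ hμ0 hμδ x hx => ?_⟩
  have hxK : x ∈ Kᗮ := fun y (hy : A y = 0) => by
    have hmul : μ * inner ℝ y x = 0 := by
      rw [← real_inner_smul_right, ← hx, ← inner_zero_left x, ← hy]
      exact (hsa.isSymmetric y x).symm
    exact (mul_eq_zero.mp hmul).resolve_left hμ0
  have hGx : (⟨x, hxK⟩ : Kᗮ) = μ • G ⟨x, hxK⟩ := by
    have hA'x : A' ⟨x, hxK⟩ = μ • ⟨x, hxK⟩ := Subtype.ext ((hA' _).trans hx)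
    rw [← map_smul, ← hA'x]
    exact (DFunLike.congr_fun hG _).symm
  by_contra hx0
  have hle : ‖x‖ ≤ |μ| * (‖G‖ * ‖x‖) := by
    calc ‖x‖ = ‖μ • G ⟨x, hxK⟩‖ := congrArg (fun w : Kᗮ => ‖w‖) hGx
      _ ≤ |μ| * (‖G‖ * ‖x‖) := by
        rw [norm_smul, Real.norm_eq_abs]
        gcongr
        exact G.le_opNorm _
  have hlt : |μ| * (‖G‖ + 1) < 1 := (lt_div_iff₀ (by positivity)).mp hμδ
  nlinarith [norm_pos_iff.mpr hx0, abs_nonneg μ]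

theorem zero_notMem_spectrum_or_isolated (hA : IsEssentiallyCoercive A) (hsa : IsSelfAdjoint A) :
    (0 : ℝ) ∉ spectrum ℝ A ∨ ∃ ε > 0, spectrum ℝ A ∩ Metric.ball 0 ε = {0} := by
  obtain ⟨c, hc, hAc⟩ := hA.exists_forall_sub_smul
  obtain ⟨δ, hδ, hev⟩ := hA.exists_forall_abs_lt_eq_smul_imp hsa
  refine or_iff_not_imp_left.mpr fun h0 => ⟨min δ c, lt_min hδ hc,
    eq_singleton_iff_unique_mem.mpr ⟨⟨not_not.mp h0, Metric.mem_ball_self (lt_min hδ hc)⟩, ?_⟩⟩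
  rintro μ ⟨hspec, hball⟩
  obtain ⟨hμδ, hμc⟩ := lt_min_iff.mp (mem_ball_zero_iff.mp hball)
  by_contra hμ0
  refine spectrum.mem_iff.mp hspec (IsUnit.sub_iff.mp ?_)
  exact (hAc μ ((le_abs_self μ).trans_lt hμc)).isUnit_of_injective fun x hx =>
    hev μ hμ0 hμδ x (sub_eq_zero.mp hx)

end IsEssentiallyCoercive

theorem IsNegativeSpace.eq_negEigenspan [CompleteSpace H] {B : H →L[ℝ] H}
    (hB : IsSelfAdjoint B) (hneg : IsNegativeSpace B (negEigenspan B)) {V : Submodule ℝ H}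
    (hV : IsNegativeSpace B V) : V = negEigenspan B := by
  have := hV.closed.completeSpace_coe
  have := hneg.closed.completeSpace_coe
  have hle : negEigenspan B ≤ V := iSup_le fun μ x hx => by
    have hx : B x = (μ : ℝ) • x := Module.End.mem_eigenspace_iff.mp hx
    obtain ⟨a, ha, b, hb, rfl⟩ := V.exists_add_mem_mem_orthogonal x
    have hBb : B b = (μ : ℝ) • b := by
      have hsum : (B b - (μ : ℝ) • b) + (B a - (μ : ℝ) • a) = 0 := by
        rw [sub_add_sub_comm, ← map_add, ← smul_add, add_comm b a, hx, sub_self]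
      have hmem : B b - (μ : ℝ) • b ∈ V := by
        rw [eq_neg_of_add_eq_zero_left hsum]
        exact V.neg_mem (V.sub_mem (hV.invariant a ha) (V.smul_mem _ ha))
      have hmem' : B b - (μ : ℝ) • b ∈ Vᗮ :=
        Vᗮ.sub_mem (map_mem_orthogonal hB (fun v => hV.invariant v) hb) (Vᗮ.smul_mem _ hb)
      exact sub_eq_zero.mp (inner_self_eq_zero.mp (hmem' _ hmem))
    have hb0 : b = 0 := by
      by_contra hb0
      have hform := hV.nonneg b hb
      rw [hBb, real_inner_smul_left] at hform
      exact hform.not_gt (mul_neg_of_neg_of_pos μ.2 (real_inner_self_pos.mpr hb0))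
    simpa [hb0] using ha
  refine le_antisymm (fun v hv => ?_) hle
  obtain ⟨a, ha, b, hb, rfl⟩ := (negEigenspan B).exists_add_mem_mem_orthogonal v
  have hbV : b ∈ V := by simpa using V.sub_mem hv (hle ha)
  have hb0 : b = 0 := by
    by_contra hb0
    exact (hV.neg b hbV hb0).not_ge (hneg.nonneg b hb)
  simpa [hb0] using ha

end EssentiallyCoercive

section PeriodicFunctions

variable {T : ℝ} {E : Type*} [NormedAddCommGroup E]

theorem exists_norm_le_of_periodic (hT : T ≠ 0) {f : ℝ → E} (hf : Continuous f)
    (hper : Periodic f T) : ∃ C, ∀ t, ‖f t‖ ≤ C := by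
  obtain ⟨C, hC⟩ := (hper.isBounded_of_continuous hT hf).exists_norm_le
  exact ⟨C, fun t => hC _ (mem_range_self t)⟩

theorem periodic_primitive [NormedSpace ℝ E] {f : ℝ → E} (hper : Periodic f T)
    (hInt : ∀ a b, IntervalIntegrable f volume a b) (h0 : ∫ s in (0 : ℝ)..T, f s = 0) :
    Periodic (fun t => ∫ s in (0 : ℝ)..t, f s) T := fun t => by
  have hadd := hper.intervalIntegral_add_eq_add 0 t hInt
  rwa [zero_add, h0, add_zero] at hadd

theorem locallyFinite_support_translates (hT : 0 < T) {f : ℝ → E} (hf : support f ⊆ Ioo 0 T) :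
    LocallyFinite fun k : ℤ => support fun t => f (t + k * T) := fun t₀ => by
  refine ⟨Metric.ball t₀ 1, Metric.ball_mem_nhds _ one_pos,
    (Set.finite_Icc ⌈(-t₀ - 1) / T⌉ ⌊(T - t₀ + 1) / T⌋).subset ?_⟩
  rintro k ⟨t, ht, htball⟩
  obtain ⟨hpos, hlt⟩ := hf ht
  rw [Metric.mem_ball, Real.dist_eq, abs_lt] at htball
  rw [mem_Icc, Int.ceil_le, Int.le_floor, div_le_iff₀ hT, le_div_iff₀ hT]
  constructor <;> linarith

theorem exists_periodic_extension [NormedSpace ℝ E] (hT : 0 < T) {f : ℝ → E}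
    (hf : ContDiff ℝ ∞ f) (hsupp : tsupport f ⊆ Ioo 0 T) :
    ∃ g : ℝ → E, ContDiff ℝ ∞ g ∧ Periodic g T ∧ EqOn g f (Ioc 0 T) := by
  refine ⟨fun t => ∑ᶠ k : ℤ, f (t + k * T), ?_, fun t => ?_, fun t ht => ?_⟩
  · rw [← contMDiff_iff_contDiff]
    exact contMDiff_finsum (fun k => (hf.comp (contDiff_id.add contDiff_const)).contMDiff)
      (locallyFinite_support_translates hT (subset_closure.trans hsupp))
  · refine finsum_eq_of_bijective (· + 1) (Equiv.addRight (1 : ℤ)).bijective fun k => ?_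
    push_cast
    ring_nf
  · beta_reduce
    rw [finsum_eq_single _ (0 : ℤ) fun k hk => ?_, Int.cast_zero, zero_mul, add_zero]
    refine image_eq_zero_of_notMem_tsupport fun hmem => hk ?_
    obtain ⟨hpos, hlt⟩ := hsupp hmem
    have hk_lt : (k : ℝ) < 1 := lt_of_mul_lt_mul_right (by linarith [ht.1]) hT.le
    have hlt_k : (-1 : ℝ) < k := lt_of_mul_lt_mul_right (by linarith [ht.2]) hT.le
    exact le_antisymm (Int.lt_add_one_iff.mp (by exact_mod_cast hk_lt))
      (Int.add_one_le_of_lt (by exact_mod_cast hlt_k))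

theorem exists_periodic_primitive [NormedSpace ℝ E] [CompleteSpace E] {θ : ℝ → E}
    (hθ : ContDiff ℝ ∞ θ) (hper : Periodic θ T) (hmean : ∫ t in (0 : ℝ)..T, θ t = 0) :
    ∃ ψ : ℝ → E, ContDiff ℝ ∞ ψ ∧ Periodic ψ T ∧ deriv ψ = θ := by
  have hd : ∀ t, HasDerivAt (fun t => ∫ s in (0 : ℝ)..t, θ s) (θ t) t := fun t =>
    (hθ.continuous.integral_hasStrictDerivAt 0 t).hasDerivAt
  have hderiv : deriv (fun t => ∫ s in (0 : ℝ)..t, θ s) = θ := funext fun t => (hd t).deriv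
  refine ⟨_, contDiff_infty_iff_deriv.mpr ⟨fun t => (hd t).differentiableAt, ?_⟩,
    periodic_primitive hper (hθ.continuous.intervalIntegrable) hmean, hderiv⟩
  rwa [hderiv]

end PeriodicFunctions

section DuBoisReymond

variable {T : ℝ} {E : Type*} [NormedAddCommGroup E] [NormedSpace ℝ E]

theorem integrable_continuous_smul {f : ℝ → ℝ} (hf : Continuous f) {u : ℝ → E}
    (hu : Integrable u (perMeas T)) : Integrable (fun t => f t • u t) (perMeas T) := by
  obtain ⟨C, hC⟩ := (isCompact_Icc (a := (0 : ℝ)) (b := T)).exists_bound_of_continuousOn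
    hf.continuousOn
  refine Integrable.bdd_smul hu C hf.aestronglyMeasurable ?_
  filter_upwards [ae_restrict_mem measurableSet_Ioc] with t ht
  exact hC t (Ioc_subset_Icc_self ht)

theorem setIntegral_Ioc_eq_integral {f : ℝ → E} (hf : support f ⊆ Ioo 0 T) :
    ∫ t in Ioc 0 T, f t = ∫ t, f t :=
  setIntegral_eq_integral_of_forall_compl_eq_zero fun _ ht =>
    notMem_support.mp fun hne => ht (Ioo_subset_Ioc_self (hf hne))

theorem exists_contDiff_tsupport_subset_Ioo_integral_eq_one (hT : 0 < T) :
    ∃ χ : ℝ → ℝ, ContDiff ℝ ∞ χ ∧ tsupport χ ⊆ Ioo 0 T ∧ ∫ t in Ioc 0 T, χ t = 1 := by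
  let χ : ContDiffBump (T / 2) := ⟨T / 8, T / 4, by positivity, by linarith⟩
  have hsupp : tsupport (χ.normed volume) ⊆ Ioo 0 T := by
    rw [χ.tsupport_normed_eq, Real.closedBall_eq_Icc]
    refine Icc_subset_Ioo ?_ ?_ <;> simp only [χ] <;> linarith
  refine ⟨χ.normed volume, χ.contDiff_normed, hsupp, ?_⟩
  rw [setIntegral_Ioc_eq_integral (subset_closure.trans hsupp), χ.integral_normed]

theorem setIntegral_smul_eq_zero_of_integral_eq_zero (hT : 0 < T) {g : ℝ → E}
    (h : ∀ ψ : ℝ → ℝ, ContDiff ℝ ∞ ψ → Periodic ψ T → ∫ t in Ioc 0 T, deriv ψ t • g t = 0)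
    {θ : ℝ → ℝ} (hθ : ContDiff ℝ ∞ θ) (hsupp : tsupport θ ⊆ Ioo 0 T)
    (hmean : ∫ t in Ioc 0 T, θ t = 0) : ∫ t in Ioc 0 T, θ t • g t = 0 := by
  obtain ⟨θ', hθ', hper, heq⟩ := exists_periodic_extension hT hθ hsupp
  have hmean' : ∫ t in (0 : ℝ)..T, θ' t = 0 := by
    rw [intervalIntegral.integral_of_le hT.le, setIntegral_congr_fun measurableSet_Ioc heq, hmean]
  obtain ⟨ψ, hψ, hψper, rfl⟩ := exists_periodic_primitive hθ' hper hmean'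
  rw [← h ψ hψ hψper]
  exact setIntegral_congr_fun measurableSet_Ioc fun t ht => by rw [heq ht]

/-- The du Bois-Reymond lemma on the circle. The constant is the mean of `g` against a fixed
bump `χ` of integral `1`: every test function differs from a multiple of `χ` by the derivative of
a periodic function. -/
theorem ae_eq_const_of_integral_deriv_smul_eq_zero [CompleteSpace E] (hT : 0 < T) {g : ℝ → E}
    (hg : Integrable g (perMeas T))
    (h : ∀ ψ : ℝ → ℝ, ContDiff ℝ ∞ ψ → Periodic ψ T → ∫ t in Ioc 0 T, deriv ψ t • g t = 0) :
    ∃ c : E, g =ᵐ[perMeas T] fun _ => c := by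
  obtain ⟨χ, hχ, hχsupp, hχint⟩ := exists_contDiff_tsupport_subset_Ioo_integral_eq_one hT
  set c := ∫ t in Ioc 0 T, χ t • g t with hc
  have htest : ∀ θ : ℝ → ℝ, ContDiff ℝ ∞ θ → HasCompactSupport θ → tsupport θ ⊆ Ioo 0 T →
      ∫ t, θ t • (g t - c) = 0 := fun θ hθ _ hsupp => by
    have hθg := integrable_continuous_smul hθ.continuous hg
    have hχg := integrable_continuous_smul hχ.continuous hg
    set I := ∫ t in Ioc 0 T, θ t with hI
    have hzero : ∫ t in Ioc 0 T, (θ t - I * χ t) • g t = 0 := by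
      refine setIntegral_smul_eq_zero_of_integral_eq_zero hT h (hθ.sub (contDiff_const.mul hχ))
        ((tsupport_sub _ _).trans (union_subset hsupp
          ((tsupport_mul_subset_right (f := fun _ => I)).trans hχsupp))) ?_
      rw [integral_sub hθ.continuous.integrableOn_Ioc
        (hχ.continuous.integrableOn_Ioc.const_mul I), integral_const_mul, hχint, mul_one, sub_self]
    simp only [sub_smul, mul_smul] at hzero
    rw [integral_sub hθg (hχg.fun_smul I), integral_smul, ← hc] at hzero
    rw [← setIntegral_Ioc_eq_integral (f := fun t => θ t • (g t - c))
      ((support_smul_subset_left θ _).trans (subset_closure.trans hsupp))]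
    simp only [smul_sub]
    rw [integral_sub hθg (hθ.continuous.integrableOn_Ioc.smul_const c), integral_smul_const, ← hI,
      hzero]
  have hae := isOpen_Ioo.ae_eq_zero_of_integral_contDiff_smul_eq_zero (μ := volume)
    (IntegrableOn.locallyIntegrableOn ((hg.sub (integrable_const c)).mono_measure
      (Measure.restrict_mono Ioo_subset_Ioc_self le_rfl))) htest
  refine ⟨c, ?_⟩
  rw [perMeas, ← restrict_Ioo_eq_restrict_Ioc]
  filter_upwards [ae_restrict_of_ae hae, ae_restrict_mem measurableSet_Ioo] with t ht ht'
  exact sub_eq_zero.mp (ht ht')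

theorem continuousOn_primitive (hT : 0 ≤ T) {w : ℝ → E} (hw : Integrable w (perMeas T)) :
    ContinuousOn (fun t => ∫ s in (0 : ℝ)..t, w s) (Icc 0 T) := by
  rw [← uIcc_of_le hT]
  exact intervalIntegral.continuousOn_primitive_interval'
    ((intervalIntegrable_iff_integrableOn_Ioc_of_le hT).mpr hw) left_mem_uIcc

theorem integrable_primitive (hT : 0 ≤ T) {w : ℝ → E} (hw : Integrable w (perMeas T)) :
    Integrable (fun t => ∫ s in (0 : ℝ)..t, w s) (perMeas T) :=
  (continuousOn_primitive hT hw).integrableOn_Icc.mono_set Ioc_subset_Icc_self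

theorem integral_deriv_mul_primitive (hT : 0 ≤ T) {f : ℝ → ℝ} (hf : Integrable f (perMeas T))
    (h0 : ∫ t, f t ∂(perMeas T) = 0) {ψ : ℝ → ℝ} (hψ : ContDiff ℝ 1 ψ) :
    ∫ t, deriv ψ t * (∫ s in (0 : ℝ)..t, f s) ∂(perMeas T) = -∫ t, ψ t * f t ∂(perMeas T) := by
  have hfi : IntervalIntegrable f volume 0 T :=
    (intervalIntegrable_iff_integrableOn_Ioc_of_le hT).mpr hf
  have hparts := (hfi.absolutelyContinuousOnInterval_intervalIntegral (c := 0)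
    left_mem_uIcc).integral_mul_deriv_eq_deriv_mul hψ.contDiffOn.absolutelyContinuousOnInterval
  rw [intervalIntegral.integral_of_le hT (f := f), h0, intervalIntegral.integral_same, zero_mul,
    zero_mul, sub_zero, zero_sub, intervalIntegral.integral_of_le hT,
    intervalIntegral.integral_of_le hT] at hparts
  simp only [mul_comm (deriv ψ _)]
  refine hparts.trans (congrArg Neg.neg (integral_congr_ae ?_))
  filter_upwards [ae_restrict_of_ae hfi.ae_hasDerivAt_integral,
    ae_restrict_mem measurableSet_Ioc] with t hderiv ht
  rw [(hderiv (uIcc_of_le hT ▸ Ioc_subset_Icc_self ht) 0 left_mem_uIcc).deriv, mul_comm]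

theorem integral_deriv_smul_primitive {F : Type*} [NormedAddCommGroup F] [InnerProductSpace ℝ F]
    [CompleteSpace F] (hT : 0 ≤ T) {w : ℝ → F} (hw : Integrable w (perMeas T))
    (h0 : ∫ t, w t ∂(perMeas T) = 0) {ψ : ℝ → ℝ} (hψ : ContDiff ℝ 1 ψ) :
    ∫ t, deriv ψ t • (∫ s in (0 : ℝ)..t, w s) ∂(perMeas T) = -∫ t, ψ t • w t ∂(perMeas T) := by
  refine ext_inner_left ℝ fun e => ?_
  have hprim : ∀ t ∈ Ioc 0 T,
      inner ℝ e (∫ s in (0 : ℝ)..t, w s) = ∫ s in (0 : ℝ)..t, inner ℝ e (w s) := fun t ht => by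
    rw [intervalIntegral.integral_of_le ht.1.le, intervalIntegral.integral_of_le ht.1.le]
    exact (integral_inner (IntegrableOn.mono_set hw (Ioc_subset_Ioc_right ht.2)) e).symm
  rw [inner_neg_right, ← integral_inner (integrable_continuous_smul (hψ.continuous_deriv le_rfl)
    (integrable_primitive hT hw)), ← integral_inner (integrable_continuous_smul hψ.continuous hw)]
  simp only [real_inner_smul_right]
  rw [← integral_deriv_mul_primitive hT (hw.const_inner e) _ hψ]
  · exact setIntegral_congr_fun measurableSet_Ioc fun t ht => by rw [hprim t ht]
  · rw [integral_inner hw, h0, inner_zero_right]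

end DuBoisReymond

section WeakDerivative

variable {T : ℝ} {n : ℕ} {u w : L2 T n}

theorem L2.integrable (u : L2 T n) : Integrable u (perMeas T) :=
  (Lp.memLp u).integrable one_le_two

theorem IsWeakDeriv.integral_deriv_smul (h : IsWeakDeriv u w) {ψ : ℝ → ℝ} (hψ : ContDiff ℝ ∞ ψ)
    (hper : Periodic ψ T) :
    ∫ t, deriv ψ t • u t ∂(perMeas T) = -∫ t, ψ t • w t ∂(perMeas T) := by
  refine ext_inner_left ℝ fun e => ?_
  rw [inner_neg_right, ← integral_inner (integrable_continuous_smul (hψ.continuous_deriv (by simp))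
    u.integrable), ← integral_inner (integrable_continuous_smul hψ.continuous w.integrable)]
  have htest := h (fun t => ψ t • e) (hψ.smul contDiff_const) (fun t => by simp [hper t])
  have hderiv : ∀ t, deriv (fun t => ψ t • e) t = deriv ψ t • e := fun t =>
    ((hψ.differentiable (by simp) t).hasDerivAt.smul_const e).deriv
  simp only [hderiv, real_inner_smul_right] at htest ⊢
  simpa only [real_inner_comm] using htest

theorem IsWeakDeriv.integral_eq_zero (h : IsWeakDeriv u w) : ∫ t, w t ∂(perMeas T) = 0 := by
  simpa using (h.integral_deriv_smul (ψ := fun _ => 1) contDiff_const fun _ => rfl).symm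

theorem IsWeakDeriv.exists_ae_eq_primitive (hT : 0 < T) (h : IsWeakDeriv u w) :
    ∃ c : Eu n, u =ᵐ[perMeas T] fun t => c + ∫ s in (0 : ℝ)..t, w s := by
  have hprim := integrable_primitive hT.le w.integrable
  obtain ⟨c, hc⟩ := ae_eq_const_of_integral_deriv_smul_eq_zero hT
    (g := fun t => u t - ∫ s in (0 : ℝ)..t, w s) (u.integrable.sub hprim) fun ψ hψ hper => by
      have hcont := hψ.continuous_deriv (n := ∞) (by simp)
      simp only [smul_sub]
      rw [integral_sub (integrable_continuous_smul hcont u.integrable)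
        (integrable_continuous_smul hcont hprim), h.integral_deriv_smul hψ hper,
        integral_deriv_smul_primitive hT.le w.integrable h.integral_eq_zero (hψ.of_le (by simp)),
        sub_self]
  exact ⟨c, hc.mono fun t ht => sub_eq_iff_eq_add.mp ht⟩

theorem exists_periodic_ae_eq (hT : 0 < T) {E : Type*} [NormedAddCommGroup E] {w : ℝ → E}
    (hw : Integrable w (perMeas T)) :
    ∃ W : ℝ → E, Periodic W T ∧ (∀ a b, IntervalIntegrable W volume a b) ∧
      w =ᵐ[perMeas T] W := by
  have hper : Periodic (fun t => w (toIocMod hT 0 t)) T := fun t => by simp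
  have heq : EqOn w (fun t => w (toIocMod hT 0 t)) (Ioc 0 T) := fun t ht => by
    beta_reduce
    rw [(toIocMod_eq_self hT).mpr (by simpa using ht)]
  refine ⟨_, hper, fun a b => hper.intervalIntegrable (t := 0) hT.ne' ?_ a b, ?_⟩
  · rw [zero_add, intervalIntegrable_iff_integrableOn_Ioc_of_le hT.le]
    exact IntegrableOn.congr_fun hw heq measurableSet_Ioc
  · filter_upwards [ae_restrict_mem measurableSet_Ioc] with t ht using heq ht

theorem intervalIntegral_congr_ae_perMeas {E : Type*} [NormedAddCommGroup E] [NormedSpace ℝ E]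
    {w W : ℝ → E} (h : w =ᵐ[perMeas T] W) {t : ℝ} (ht : t ∈ Icc 0 T) :
    ∫ s in (0 : ℝ)..t, w s = ∫ s in (0 : ℝ)..t, W s := by
  rw [intervalIntegral.integral_of_le ht.1, intervalIntegral.integral_of_le ht.1]
  exact integral_congr_ae
    (ae_restrict_of_ae_restrict_of_subset (Ioc_subset_Ioc_right ht.2) h)

theorem IsWeakDeriv.exists_ae_eq_periodic_primitive (hT : 0 < T) (h : IsWeakDeriv u w)
    {W : ℝ → Eu n} (hW : ∀ a b, IntervalIntegrable W volume a b) (hper : Periodic W T)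
    (hwW : w =ᵐ[perMeas T] W) :
    ∃ c : Eu n, Periodic (fun t => c + ∫ s in (0 : ℝ)..t, W s) T ∧
      u =ᵐ[perMeas T] fun t => c + ∫ s in (0 : ℝ)..t, W s := by
  obtain ⟨c, hc⟩ := h.exists_ae_eq_primitive hT
  have hmean : ∫ s in (0 : ℝ)..T, W s = 0 := by
    rw [← intervalIntegral_congr_ae_perMeas hwW (right_mem_Icc.mpr hT.le),
      intervalIntegral.integral_of_le hT.le, h.integral_eq_zero]
  refine ⟨c, fun t => congrArg (c + ·) (periodic_primitive hper hW hmean t), ?_⟩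
  filter_upwards [hc, ae_restrict_mem measurableSet_Ioc] with t ht ht'
  rw [ht, intervalIntegral_congr_ae_perMeas hwW (Ioc_subset_Icc_self ht')]

theorem IsWeakDeriv.exists_continuous_periodic (hT : 0 < T) (h : IsWeakDeriv u w) :
    ∃ U : ℝ → Eu n, Continuous U ∧ Periodic U T ∧ u =ᵐ[perMeas T] U := by
  obtain ⟨W, hper, hInt, hwW⟩ := exists_periodic_ae_eq hT w.integrable
  obtain ⟨c, hcper, hc⟩ := h.exists_ae_eq_periodic_primitive hT hInt hper hwW
  exact ⟨_, continuous_const.add (intervalIntegral.continuous_primitive hInt 0), hcper, hc⟩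

end WeakDerivative

section Regularity

variable {T : ℝ} {n : ℕ}

/-- The function that underlies an element of `W^{1,2}(S_T, ℝⁿ)`. -/
def valL (T : ℝ) (n : ℕ) : W12 T n →L[ℝ] L2 T n :=
  (WithLp.fstL 2 ℝ (L2 T n) (L2 T n)).comp (W12 T n).subtypeL

/-- The weak derivative of an element of `W^{1,2}(S_T, ℝⁿ)`. -/
def derivL (T : ℝ) (n : ℕ) : W12 T n →L[ℝ] L2 T n :=
  (WithLp.sndL 2 ℝ (L2 T n) (L2 T n)).comp (W12 T n).subtypeL

theorem W12_ext {ξ η : W12 T n} (hval : valL T n ξ = valL T n η)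
    (hderiv : derivL T n ξ = derivL T n η) : ξ = η :=
  Subtype.ext ((WithLp.ofLp_injective 2) (Prod.ext hval hderiv))

theorem inner_W12 (ξ η : W12 T n) :
    inner ℝ ξ η = inner ℝ (valL T n ξ) (valL T n η) + inner ℝ (derivL T n ξ) (derivL T n η) :=
  WithLp.prod_inner_apply ξ.1 η.1

theorem norm_sq_W12 (ξ : W12 T n) : ‖ξ‖ ^ 2 = ‖valL T n ξ‖ ^ 2 + ‖derivL T n ξ‖ ^ 2 := by
  simp only [← real_inner_self_eq_norm_sq, inner_W12]

theorem isWeakDeriv_W12 (ξ : W12 T n) : IsWeakDeriv (valL T n ξ) (derivL T n ξ) := ξ.2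

theorem coeFn_valL_incl (p : C1 T n) : valL T n (incl T n p) =ᵐ[perMeas T] p.1.1 :=
  (memLp_of_continuous (T := T) p.1.1.continuous).coeFn_toLp

theorem coeFn_derivL_incl (p : C1 T n) : derivL T n (incl T n p) =ᵐ[perMeas T] p.1.2 :=
  (memLp_of_continuous (T := T) p.1.2.continuous).coeFn_toLp

theorem periodic_of_hasDerivAt {E : Type*} [NormedAddCommGroup E] [NormedSpace ℝ E]
    {f g : ℝ → E} (hper : Periodic f T) (hd : ∀ t, HasDerivAt f (g t) t) : Periodic g T := fun t =>
  ((hd (t + T)).comp_add_const t T).unique (by simpa only [hper _] using hd t)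

theorem exists_C1 (hT : T ≠ 0) {f g : ℝ → Eu n} (hper : Periodic f T)
    (hd : ∀ t, HasDerivAt f (g t) t) (hg : Continuous g) :
    ∃ p : C1 T n, p.1.1 = f ∧ p.1.2 = g := by
  have hf : Continuous f := continuous_iff_continuousAt.mpr fun t => (hd t).continuousAt
  obtain ⟨C, hC⟩ := exists_norm_le_of_periodic hT hf hper
  obtain ⟨C', hC'⟩ := exists_norm_le_of_periodic hT hg (periodic_of_hasDerivAt hper hd)
  exact ⟨⟨(BoundedContinuousFunction.ofNormedAddCommGroup f hf C hC,
    BoundedContinuousFunction.ofNormedAddCommGroup g hg C' hC'), hper, hd⟩, rfl, rfl⟩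

theorem mem_range_incl_of_derivL_ae_eq (hT : 0 < T) (ξ : W12 T n) {W : ℝ → Eu n}
    (hW : Continuous W) (hper : Periodic W T) (hξ : derivL T n ξ =ᵐ[perMeas T] W) :
    ξ ∈ LinearMap.range (incl T n) := by
  obtain ⟨c, hcper, hc⟩ := (isWeakDeriv_W12 ξ).exists_ae_eq_periodic_primitive hT
    (fun a b => hW.intervalIntegrable a b) hper hξ
  obtain ⟨p, hp, hp'⟩ := exists_C1 hT.ne' hcper
    (fun t => (hW.integral_hasStrictDerivAt 0 t).hasDerivAt.const_add c) hW
  exact ⟨p, W12_ext (Lp.ext ((coeFn_valL_incl p).trans (hp ▸ hc.symm)))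
    (Lp.ext ((coeFn_derivL_incl p).trans (hp' ▸ hξ.symm)))⟩

theorem isWeakDeriv_of_inner_incl (hT : T ≠ 0) {f k : L2 T n}
    (h : ∀ η : C1 T n,
      inner ℝ f (derivL T n (incl T n η)) + inner ℝ k (valL T n (incl T n η)) = 0) :
    IsWeakDeriv f k := by
  rw [isWeakDeriv_iff]
  intro ψ hψ hper
  obtain ⟨p, rfl, hp'⟩ := exists_C1 hT hper
    (fun t => (hψ.differentiable (by simp) t).hasDerivAt) (hψ.continuous_deriv (by simp))
  simp only [← hp']
  exact h p

theorem continuous_ringInverse {X : Type*} [TopologicalSpace X] {R : Type*} [NormedRing R]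
    [HasSummableGeomSeries R] {P : X → R} (hP : Continuous P) (hunit : ∀ x, IsUnit (P x)) :
    Continuous fun x => Ring.inverse (P x) := continuous_iff_continuousAt.mpr fun x =>
  ((hunit x).unit_spec ▸ NormedRing.inverse_continuousAt (hunit x).unit).comp hP.continuousAt

/-- Elliptic regularity in one dimension: the equation makes `P ξ' + V` continuous, and then `ξ'`
is recovered by inverting `P`. -/
theorem mem_range_incl_of_isWeakDeriv (hT : 0 < T) {ξ : W12 T n} {f k : L2 T n}
    (h : IsWeakDeriv f k) {P : ℝ → Eu n →L[ℝ] Eu n} (hP : Continuous P) (hPper : Periodic P T)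
    (hunit : ∀ t, IsUnit (P t)) {V : ℝ → Eu n} (hV : Continuous V) (hVper : Periodic V T)
    (hf : f =ᵐ[perMeas T] fun t => P t (derivL T n ξ t) + V t) :
    ξ ∈ LinearMap.range (incl T n) := by
  obtain ⟨F, hF, hFper, hfF⟩ := h.exists_continuous_periodic hT
  refine mem_range_incl_of_derivL_ae_eq hT ξ (W := fun t => Ring.inverse (P t) (F t - V t))
    ((continuous_ringInverse hP hunit).clm_apply (hF.sub hV))
    (fun t => by simp only [hPper t, hFper t, hVper t]) ?_
  filter_upwards [hf, hfF] with t hft hFt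
  rw [← hFt, hft, add_sub_cancel_right, ← mul_apply_eq_comp,
    Ring.inverse_mul_cancel _ (hunit t), one_apply_eq_self]

/-- An element of `W^{1,2}` orthogonal to `C¹` is of class `C¹` by regularity, hence vanishes. -/
theorem denseRange_incl (hT : 0 < T) : DenseRange (incl T n) := by
  refine Submodule.dense_iff_topologicalClosure_eq_top.mpr
    ((LinearMap.range (incl T n)).topologicalClosure_eq_top_iff.mpr
      (eq_bot_iff.mpr fun ξ hξ => ?_))
  have hweak : IsWeakDeriv (derivL T n ξ) (valL T n ξ) :=
    isWeakDeriv_of_inner_incl hT.ne' fun η => by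
      rw [add_comm, ← inner_W12, real_inner_comm]
      exact hξ (incl T n η) ⟨η, rfl⟩
  exact inner_self_eq_zero.mp <| hξ ξ <| mem_range_incl_of_isWeakDeriv hT hweak (P := fun _ => 1)
    continuous_const (fun _ => rfl) (fun _ => isUnit_one) (V := fun _ => 0) continuous_const
    (fun _ => rfl) (Eventually.of_forall fun t => (add_zero _).symm)

end Regularity

section Multiplication

variable {T : ℝ} {n : ℕ} {P Q Q' R : C(ℝ, Eu n →L[ℝ] Eu n)}

theorem memLp_top_perMeas {E : Type*} [NormedAddCommGroup E] [SecondCountableTopology E]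
    (T : ℝ) (f : C(ℝ, E)) : MemLp f ⊤ (perMeas T) := by
  obtain ⟨C, hC⟩ := (isCompact_Icc (a := (0 : ℝ)) (b := T)).exists_bound_of_continuousOn
    f.continuous.continuousOn
  refine memLp_top_of_bound f.continuous.aestronglyMeasurable C ?_
  filter_upwards [ae_restrict_mem measurableSet_Ioc] with t ht
    using hC t (Ioc_subset_Icc_self ht)

/-- Multiplication by a continuous operator-valued function, as an operator on `L²`. -/
def mulOp (T : ℝ) (P : C(ℝ, Eu n →L[ℝ] Eu n)) : L2 T n →L[ℝ] L2 T n :=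
  (ContinuousLinearMap.id ℝ (Eu n →L[ℝ] Eu n)).holderL (perMeas T) ⊤ 2 2
    (memLp_top_perMeas T P).toLp

theorem coeFn_mulOp (P : C(ℝ, Eu n →L[ℝ] Eu n)) (u : L2 T n) :
    mulOp T P u =ᵐ[perMeas T] fun t => P t (u t) := by
  filter_upwards [(memLp_top_perMeas T P).coeFn_toLp,
    (ContinuousLinearMap.id ℝ (Eu n →L[ℝ] Eu n)).coeFn_holder (r := 2)
      (memLp_top_perMeas T P).toLp u] with t hP hmul
  rw [← hP]
  exact hmul

theorem mulOp_sub_smul_one (P : C(ℝ, Eu n →L[ℝ] Eu n)) (μ : ℝ) (u : L2 T n) :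
    mulOp T (P - μ • 1) u = mulOp T P u - μ • u := by
  refine Lp.ext ?_
  filter_upwards [coeFn_mulOp (P - μ • 1) u, coeFn_mulOp P u, Lp.coeFn_smul μ u,
    Lp.coeFn_sub (mulOp T P u) (μ • u)] with t hsub hP hsmul hdiff
  rw [hsub, hdiff, Pi.sub_apply, hP, hsmul]
  rfl

theorem inner_mulOp_eq_integral (P : C(ℝ, Eu n →L[ℝ] Eu n)) {u v : L2 T n} {f g : ℝ → Eu n}
    (hu : u =ᵐ[perMeas T] f) (hv : v =ᵐ[perMeas T] g) :
    inner ℝ (mulOp T P u) v = ∫ t, inner ℝ (P t (f t)) (g t) ∂(perMeas T) := by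
  rw [L2.inner_def]
  refine integral_congr_ae ?_
  filter_upwards [coeFn_mulOp P u, hu, hv] with t hmul hut hvt
  rw [hmul, hut, hvt]

theorem adjoint_mulOp (h : ∀ t v w, inner ℝ (P t v) w = inner ℝ v (Q t w)) :
    (mulOp T P).adjoint = mulOp T Q := by
  refine ((ContinuousLinearMap.eq_adjoint_iff _ _).mpr fun u v => ?_).symm
  rw [inner_mulOp_eq_integral Q .rfl .rfl, real_inner_comm, inner_mulOp_eq_integral P .rfl .rfl]
  exact integral_congr_ae (.of_forall fun t => by simp only [h, real_inner_comm])

theorem L2.norm_sq_eq_integral (u : L2 T n) : ‖u‖ ^ 2 = ∫ t, ‖u t‖ ^ 2 ∂(perMeas T) := by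
  simp only [← real_inner_self_eq_norm_sq, L2.inner_def]

theorem L2.integrable_norm_sq (u : L2 T n) : Integrable (fun t => ‖u t‖ ^ 2) (perMeas T) :=
  (Lp.memLp u).integrable_norm_pow (by norm_num)

theorem mul_norm_sq_le_inner_mulOp {p : ℝ}
    (hp : ∀ t ∈ Icc 0 T, ∀ v, p * ‖v‖ ^ 2 ≤ inner ℝ (P t v) v) (u : L2 T n) :
    p * ‖u‖ ^ 2 ≤ inner ℝ (mulOp T P u) u := by
  rw [L2.inner_def, L2.norm_sq_eq_integral, ← integral_const_mul]
  refine integral_mono_ae (u.integrable_norm_sq.const_mul p)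
    (L2.integrable_inner (𝕜 := ℝ) (mulOp T P u) u) ?_
  filter_upwards [coeFn_mulOp P u, ae_restrict_mem measurableSet_Ioc] with t hmul ht
  rw [hmul]
  exact hp t (Ioc_subset_Icc_self ht) _

/-- The operator on `W^{1,2}` of the bilinear form
`∫₀ᵀ (P ξ' · η' + Q ξ · η' + Q' ξ' · η + R ξ · η) dt`. -/
def formOp (T : ℝ) (P Q Q' R : C(ℝ, Eu n →L[ℝ] Eu n)) : W12 T n →L[ℝ] W12 T n :=
  (derivL T n).adjoint ∘L (mulOp T P ∘L derivL T n + mulOp T Q ∘L valL T n) +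
  (valL T n).adjoint ∘L (mulOp T Q' ∘L derivL T n + mulOp T R ∘L valL T n)

theorem inner_formOp (P Q Q' R : C(ℝ, Eu n →L[ℝ] Eu n)) (ξ η : W12 T n) :
    inner ℝ (formOp T P Q Q' R ξ) η =
      inner ℝ (mulOp T P (derivL T n ξ) + mulOp T Q (valL T n ξ)) (derivL T n η) +
      inner ℝ (mulOp T Q' (derivL T n ξ) + mulOp T R (valL T n ξ)) (valL T n η) := by
  simp only [formOp, add_apply, ContinuousLinearMap.comp_apply, inner_add_left,
    ContinuousLinearMap.adjoint_inner_left]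

theorem isSelfAdjoint_formOp (hP : ∀ t v w, inner ℝ (P t v) w = inner ℝ v (P t w))
    (hQ : ∀ t v w, inner ℝ (Q t v) w = inner ℝ v (Q' t w))
    (hR : ∀ t v w, inner ℝ (R t v) w = inner ℝ v (R t w)) :
    IsSelfAdjoint (formOp T P Q Q' R) := by
  have hQ' : ∀ t v w, inner ℝ (Q' t v) w = inner ℝ v (Q t w) := fun t v w => by
    rw [real_inner_comm, ← hQ, real_inner_comm]
  rw [ContinuousLinearMap.isSelfAdjoint_iff']
  simp only [formOp, map_add, ContinuousLinearMap.adjoint_comp,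
    ContinuousLinearMap.adjoint_adjoint, adjoint_mulOp hP, adjoint_mulOp hQ, adjoint_mulOp hQ',
    adjoint_mulOp hR, ContinuousLinearMap.comp_add, ContinuousLinearMap.comp_assoc]
  abel

theorem formOp_sub_smul_one (P Q Q' R : C(ℝ, Eu n →L[ℝ] Eu n)) (μ : ℝ) (ξ : W12 T n) :
    formOp T (P - μ • 1) Q Q' (R - μ • 1) ξ = formOp T P Q Q' R ξ - μ • ξ := by
  refine ext_inner_right ℝ fun η => ?_
  rw [inner_sub_left, inner_formOp, inner_formOp, inner_W12 (μ • ξ), map_smul, map_smul,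
    mulOp_sub_smul_one, mulOp_sub_smul_one]
  simp only [inner_add_left, inner_sub_left, real_inner_smul_left]
  ring

theorem mem_range_incl_of_formOp_eq_incl (hT : 0 < T) (hPper : Periodic P T)
    (hQper : Periodic Q T) (hunit : ∀ t, IsUnit (P t)) {ξ : W12 T n} {g : C1 T n}
    (h : formOp T P Q Q' R ξ = incl T n g) : ξ ∈ LinearMap.range (incl T n) := by
  obtain ⟨U, hU, hUper, hξU⟩ := (isWeakDeriv_W12 ξ).exists_continuous_periodic hT
  have hweak : IsWeakDeriv
      (mulOp T P (derivL T n ξ) + mulOp T Q (valL T n ξ) - derivL T n (incl T n g))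
      (mulOp T Q' (derivL T n ξ) + mulOp T R (valL T n ξ) - valL T n (incl T n g)) :=
    isWeakDeriv_of_inner_incl hT.ne' fun η => by
      have hform := inner_formOp P Q Q' R ξ (incl T n η)
      rw [h, inner_W12] at hform
      rw [inner_sub_left, inner_sub_left]
      linarith
  have hgper := periodic_of_hasDerivAt g.2.1 g.2.2
  refine mem_range_incl_of_isWeakDeriv hT hweak P.continuous hPper hunit
    (V := fun t => Q t (U t) - g.1.2 t) ((Q.continuous.clm_apply hU).sub g.1.2.continuous)
    (fun t => by simp only [hQper t, hUper t, hgper t]) ?_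
  filter_upwards [coeFn_mulOp P (derivL T n ξ), coeFn_mulOp Q (valL T n ξ), coeFn_derivL_incl g,
    hξU,
    Lp.coeFn_add (mulOp T P (derivL T n ξ)) (mulOp T Q (valL T n ξ)),
    Lp.coeFn_sub (mulOp T P (derivL T n ξ) + mulOp T Q (valL T n ξ)) (derivL T n (incl T n g))]
    with t hP hQ hg hu hadd hsub
  rw [hsub, Pi.sub_apply, hadd, Pi.add_apply, hP, hQ, hg, hu, add_sub_assoc]

theorem isUnit_of_inner_pos {E : Type*} [NormedAddCommGroup E] [InnerProductSpace ℝ E]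
    [FiniteDimensional ℝ E] {A : E →L[ℝ] E} (hA : ∀ v, v ≠ 0 → 0 < inner ℝ (A v) v) :
    IsUnit A := by
  have := FiniteDimensional.complete ℝ E
  have hinj : Injective A := (injective_iff_map_eq_zero A).mpr fun v hv => by
    by_contra hne
    simpa [hv] using hA v hne
  exact ContinuousLinearMap.isUnit_iff_bijective.mpr
    ⟨hinj, (A : E →ₗ[ℝ] E).injective_iff_surjective.mp hinj⟩

theorem negEigenspan_formOp_le_range_incl (hT : 0 < T) (hPper : Periodic P T)
    (hQper : Periodic Q T) (hpos : ∀ t v, v ≠ 0 → 0 < inner ℝ (P t v) v) :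
    negEigenspan (formOp T P Q Q' R) ≤ LinearMap.range (incl T n) := by
  refine iSup_le fun ⟨μ, hμ⟩ ξ hξ => ?_
  have hposμ : ∀ t v, v ≠ 0 → 0 < inner ℝ ((P - μ • 1) t v) v := fun t v hv => by
    have hnorm : μ * ‖v‖ ^ 2 ≤ 0 := mul_nonpos_of_nonpos_of_nonneg (le_of_lt hμ) (sq_nonneg _)
    have hinner : inner ℝ ((P - μ • 1) t v) v = inner ℝ (P t v) v - μ * ‖v‖ ^ 2 := by
      rw [← real_inner_self_eq_norm_sq, ← real_inner_smul_left, ← inner_sub_left]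
      rfl
    linarith [hpos t v hv]
  refine mem_range_incl_of_formOp_eq_incl (P := P - μ • 1) (R := R - μ • 1) (Q' := Q') (g := 0) hT
    (fun t => ?_) hQper (fun t => isUnit_of_inner_pos (hposμ t)) ?_
  · exact congrArg (· - μ • (1 : Eu n →L[ℝ] Eu n)) (hPper t)
  · rw [formOp_sub_smul_one, map_zero, sub_eq_zero]
    exact Module.End.mem_eigenspace_iff.mp hξ

end Multiplication

section Poincare

theorem sq_integral_le_mul_integral_sq {a b : ℝ} (hab : a ≤ b) {f : ℝ → ℝ}
    (hf : IntervalIntegrable f volume a b)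
    (hf2 : IntervalIntegrable (fun t => f t ^ 2) volume a b) :
    (∫ t in a..b, f t) ^ 2 ≤ (b - a) * ∫ t in a..b, f t ^ 2 := by
  have hquad : ∀ x : ℝ,
      0 ≤ (b - a) * (x * x) + (-2 * ∫ t in a..b, f t) * x + ∫ t in a..b, f t ^ 2 := fun x =>
    calc 0 ≤ ∫ t in a..b, (f t - x) ^ 2 :=
          intervalIntegral.integral_nonneg hab fun t _ => sq_nonneg _
      _ = ∫ t in a..b, (f t ^ 2 - 2 * x * f t + x * x) := by congr 1; ext t; ring
      _ = _ := by
        rw [intervalIntegral.integral_add (hf2.sub (hf.const_mul _)) intervalIntegrable_const,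
          intervalIntegral.integral_sub hf2 (hf.const_mul _),
          intervalIntegral.integral_const_mul, intervalIntegral.integral_const, smul_eq_mul]
        ring
  have hdiscrim := discrim_le_zero hquad
  rw [discrim] at hdiscrim
  linarith

section Interval

variable {E : Type*} [NormedAddCommGroup E] [NormedSpace ℝ E] {a b : ℝ} {U w : ℝ → E}

theorem continuousOn_of_eq_add_primitive (hw : IntervalIntegrable w volume a b)
    (hU : ∀ t ∈ uIcc a b, U t = U a + ∫ s in a..t, w s) : ContinuousOn U (uIcc a b) :=
  (continuousOn_const.add (intervalIntegral.continuousOn_primitive_interval'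
    hw left_mem_uIcc)).congr hU

theorem norm_le_integral_norm_of_integral_eq_zero [CompleteSpace E] (hab : a < b)
    (hw : IntervalIntegrable w volume a b)
    (hU : ∀ t ∈ uIcc a b, U t = U a + ∫ s in a..t, w s) (h0 : ∫ t in a..b, U t = 0)
    {t : ℝ} (ht : t ∈ uIcc a b) : ‖U t‖ ≤ ∫ s in a..b, ‖w s‖ := by
  have hpos : 0 < b - a := sub_pos.mpr hab
  have hosc : ∀ s ∈ uIcc a b, ‖U t - U s‖ ≤ ∫ r in a..b, ‖w r‖ := fun s hs => by
    have hdiff : U t - U s = ∫ r in s..t, w r := by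
      rw [hU t ht, hU s hs, add_sub_add_left_eq_sub, intervalIntegral.integral_interval_sub_left
        (hw.mono_set (uIcc_subset_uIcc_left ht)) (hw.mono_set (uIcc_subset_uIcc_left hs))]
    calc ‖U t - U s‖ ≤ |∫ r in s..t, ‖w r‖| :=
          hdiff ▸ intervalIntegral.norm_integral_le_abs_integral_norm
      _ ≤ |∫ r in a..b, ‖w r‖| := intervalIntegral.abs_integral_mono_interval
          (uIoc_subset_uIoc_of_uIcc_subset_uIcc (uIcc_subset_uIcc hs ht))
          (.of_forall fun _ => norm_nonneg _) hw.norm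
      _ = ∫ r in a..b, ‖w r‖ :=
          abs_of_nonneg (intervalIntegral.integral_nonneg hab.le fun _ _ => norm_nonneg _)
  have haverage : ∫ s in a..b, (U t - U s) = (b - a) • U t := by
    rw [intervalIntegral.integral_sub intervalIntegrable_const
      (continuousOn_of_eq_add_primitive hw hU).intervalIntegrable, h0, sub_zero,
      intervalIntegral.integral_const]
  have hbound := intervalIntegral.norm_integral_le_of_norm_le_const fun s hs =>
    hosc s (uIoc_subset_uIcc hs)
  rw [haverage, norm_smul, Real.norm_of_nonneg hpos.le, abs_of_pos hpos, mul_comm] at hbound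
  exact le_of_mul_le_mul_right hbound hpos

theorem integral_norm_sq_le_of_integral_eq_zero [CompleteSpace E] (hab : a < b)
    (hw : IntervalIntegrable w volume a b)
    (hw2 : IntervalIntegrable (fun t => ‖w t‖ ^ 2) volume a b)
    (hU : ∀ t ∈ uIcc a b, U t = U a + ∫ s in a..t, w s) (h0 : ∫ t in a..b, U t = 0) :
    ∫ t in a..b, ‖U t‖ ^ 2 ≤ (b - a) ^ 2 * ∫ t in a..b, ‖w t‖ ^ 2 :=
  calc ∫ t in a..b, ‖U t‖ ^ 2 ≤ ∫ _ in a..b, (∫ s in a..b, ‖w s‖) ^ 2 := by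
        refine intervalIntegral.integral_mono_on hab.le
          ((continuousOn_of_eq_add_primitive hw hU).norm.pow 2).intervalIntegrable
          intervalIntegrable_const fun t ht => ?_
        rw [← uIcc_of_le hab.le] at ht
        have := norm_le_integral_norm_of_integral_eq_zero hab hw hU h0 ht
        gcongr
    _ = (b - a) * (∫ t in a..b, ‖w t‖) ^ 2 := by
        rw [intervalIntegral.integral_const, smul_eq_mul]
    _ ≤ (b - a) * ((b - a) * ∫ t in a..b, ‖w t‖ ^ 2) := by
        have := sub_nonneg.mpr hab.le
        gcongr
        exact sq_integral_le_mul_integral_sq hab.le hw.norm hw2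
    _ = _ := by ring

end Interval

variable {T : ℝ} {n : ℕ}

theorem intervalIntegrable_of_integrable_perMeas {E : Type*} [NormedAddCommGroup E] {f : ℝ → E}
    (hf : Integrable f (perMeas T)) {a b : ℝ} (ha : a ∈ Icc 0 T) (hb : b ∈ Icc 0 T) :
    IntervalIntegrable f volume a b :=
  have hT : 0 ≤ T := ha.1.trans ha.2
  ((intervalIntegrable_iff_integrableOn_Ioc_of_le hT).mpr hf).mono_set
    (uIcc_of_le hT ▸ uIcc_subset_Icc ha hb)

theorem IsWeakDeriv.integral_norm_sq_le (hT : 0 < T) {u w : L2 T n} (h : IsWeakDeriv u w)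
    {a b : ℝ} (hab : a < b) (ha : a ∈ Icc 0 T) (hb : b ∈ Icc 0 T) (h0 : ∫ t in a..b, u t = 0) :
    ∫ t in a..b, ‖u t‖ ^ 2 ≤ (b - a) ^ 2 * ∫ t in a..b, ‖w t‖ ^ 2 := by
  obtain ⟨c, hc⟩ := h.exists_ae_eq_primitive hT
  set U : ℝ → Eu n := fun t => c + ∫ s in (0 : ℝ)..t, w s with hU
  have huU : ∀ᵐ t ∂volume, t ∈ uIoc a b → u t = U t := by
    rw [uIoc_of_le hab.le, ← ae_restrict_iff' measurableSet_Ioc]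
    exact ae_restrict_of_ae_restrict_of_subset (Ioc_subset_Ioc ha.1 hb.2) hc
  have hprim : ∀ t ∈ uIcc a b, U t = U a + ∫ s in a..t, w s := fun t ht => by
    have ht' : t ∈ Icc 0 T := uIcc_subset_Icc ha hb ht
    rw [hU, add_assoc, intervalIntegral.integral_add_adjacent_intervals
      (intervalIntegrable_of_integrable_perMeas w.integrable (left_mem_Icc.mpr hT.le) ha)
      (intervalIntegrable_of_integrable_perMeas w.integrable ha ht')]
  rw [intervalIntegral.integral_congr_ae huU] at h0
  rw [intervalIntegral.integral_congr_ae (huU.mono fun t ht hmem => by rw [ht hmem])]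
  exact integral_norm_sq_le_of_integral_eq_zero hab
    (intervalIntegrable_of_integrable_perMeas w.integrable ha hb)
    (intervalIntegrable_of_integrable_perMeas w.integrable_norm_sq ha hb) hprim h0

theorem exists_finiteDimensional_setIntegral_eq_zero {α E ι : Type*} [MeasurableSpace α]
    [NormedAddCommGroup E] [InnerProductSpace ℝ E] [FiniteDimensional ℝ E] [Finite ι]
    (μ : Measure α) [IsFiniteMeasure μ] {s : ι → Set α} (hs : ∀ i, MeasurableSet (s i)) :
    ∃ K : Submodule ℝ (Lp E 2 μ), FiniteDimensional ℝ K ∧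
      ∀ u ∈ Kᗮ, ∀ i, ∫ x in s i, u x ∂μ = 0 := by
  let e := stdOrthonormalBasis ℝ E
  let F : ι × Fin (Module.finrank ℝ E) → Lp E 2 μ := fun z =>
    indicatorConstLp 2 (hs z.1) (measure_ne_top μ _) (e z.2)
  refine ⟨Submodule.span ℝ (range F), FiniteDimensional.span_of_finite ℝ (finite_range F),
    fun u hu i => e.repr.injective (PiLp.ext fun j => ?_)⟩
  rw [map_zero, PiLp.zero_apply, e.repr_apply_apply,
    ← L2.inner_indicatorConstLp_eq_inner_setIntegral (𝕜 := ℝ) (hs i) (measure_ne_top μ _) (e j) u]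
  exact hu (F (i, j)) (Submodule.subset_span ⟨_, rfl⟩)

theorem L2.norm_sq_eq_sum_integral {x : ℕ → ℝ} {m : ℕ} (hx : Monotone x) (h0 : x 0 = 0)
    (hm : x m = T) (u : L2 T n) :
    ‖u‖ ^ 2 = ∑ j ∈ Finset.range m, ∫ t in x j..x (j + 1), ‖u t‖ ^ 2 := by
  have hmem : ∀ j ≤ m, x j ∈ Icc 0 T := fun j hj => ⟨h0 ▸ hx j.zero_le, hm ▸ hx hj⟩
  rw [intervalIntegral.sum_integral_adjacent_intervals fun j hj =>
    intervalIntegrable_of_integrable_perMeas u.integrable_norm_sq (hmem j hj.le) (hmem (j + 1) hj),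
    h0, hm, L2.norm_sq_eq_integral, intervalIntegral.integral_of_le (h0 ▸ hm ▸ hx m.zero_le)]

/-- If `ξ` has mean zero on each interval of a partition of mesh `≤ h`, then the Poincaré
inequalities on these intervals add up to `‖ξ‖ ≤ h ‖ξ'‖`. -/
theorem exists_finiteDimensional_norm_valL_le_of_partition (hT : 0 < T) {x : ℕ → ℝ} {m : ℕ}
    (hx : StrictMono x) (h0 : x 0 = 0) (hm : x m = T) {h : ℝ} (hh : 0 ≤ h)
    (hmesh : ∀ j, x (j + 1) - x j ≤ h) :
    ∃ K : Submodule ℝ (W12 T n), FiniteDimensional ℝ K ∧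
      ∀ ξ ∈ Kᗮ, ‖valL T n ξ‖ ≤ h * ‖derivL T n ξ‖ := by
  have hmem : ∀ j ≤ m, x j ∈ Icc 0 T := fun j hj =>
    ⟨h0 ▸ hx.monotone j.zero_le, hm ▸ hx.monotone hj⟩
  obtain ⟨K, hK, hmean⟩ := exists_finiteDimensional_setIntegral_eq_zero (E := Eu n) (perMeas T)
    (s := fun j : Fin m => Ioc (x j) (x (j + 1))) fun _ => measurableSet_Ioc
  refine ⟨K.map ((valL T n).adjoint : L2 T n →ₗ[ℝ] W12 T n), inferInstance, fun ξ hξ => ?_⟩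
  have hval : valL T n ξ ∈ Kᗮ := fun v hv => by
    rw [← ContinuousLinearMap.adjoint_inner_left]
    exact hξ _ ⟨v, hv, rfl⟩
  refine le_of_sq_le_sq ?_ (by positivity)
  rw [L2.norm_sq_eq_sum_integral hx.monotone h0 hm, mul_pow,
    L2.norm_sq_eq_sum_integral hx.monotone h0 hm (derivL T n ξ), Finset.mul_sum]
  refine Finset.sum_le_sum fun j hj => ?_
  have hj : j < m := Finset.mem_range.mp hj
  have hzero : ∫ t in x j..x (j + 1), valL T n ξ t = 0 := by
    have := hmean _ hval ⟨j, hj⟩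
    rwa [Measure.restrict_restrict measurableSet_Ioc, inter_eq_left.mpr
      (Ioc_subset_Ioc (hmem j hj.le).1 (hmem (j + 1) hj).2),
      ← intervalIntegral.integral_of_le (hx.monotone j.le_succ)] at this
  refine ((isWeakDeriv_W12 ξ).integral_norm_sq_le hT (hx j.lt_succ_self) (hmem j hj.le)
    (hmem (j + 1) hj) hzero).trans (mul_le_mul_of_nonneg_right ?_ ?_)
  · exact pow_le_pow_left₀ (sub_nonneg.mpr (hx.monotone j.le_succ)) (hmesh j) 2
  · exact intervalIntegral.integral_nonneg (hx.monotone j.le_succ) fun _ _ => sq_nonneg _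

theorem exists_finiteDimensional_norm_valL_le (hT : 0 < T) {h : ℝ} (hh : 0 < h) :
    ∃ K : Submodule ℝ (W12 T n), FiniteDimensional ℝ K ∧
      ∀ ξ ∈ Kᗮ, ‖valL T n ξ‖ ≤ h * ‖derivL T n ξ‖ := by
  obtain ⟨m, hm⟩ := exists_nat_gt (T / h)
  have hm0 : (0 : ℝ) < m := lt_trans (by positivity) hm
  let x : ℕ → ℝ := fun j => j * (T / m)
  have hstep : ∀ j, x (j + 1) - x j = T / m := fun j => by simp only [x]; push_cast; ring
  exact exists_finiteDimensional_norm_valL_le_of_partition hT (x := x) (m := m)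
    (strictMono_nat_of_lt_succ fun j => sub_pos.mp (hstep j ▸ div_pos hT hm0))
    (by simp [x]) (mul_div_cancel₀ T hm0.ne') hh.le
    fun j => (hstep j).trans_le ((div_lt_comm₀ hh hm0).mp hm).le

end Poincare

section Garding

variable {T : ℝ} {n : ℕ}

theorem neg_opNorm_mul_le_inner {E : Type*} [NormedAddCommGroup E] [InnerProductSpace ℝ E]
    (A : E →L[ℝ] E) {y z : E} {c : ℝ} (h : ‖y‖ * ‖z‖ ≤ c) : -(‖A‖ * c) ≤ inner ℝ (A y) z := by
  refine (neg_le_neg ?_).trans (neg_le_of_abs_le (abs_real_inner_le_norm (A y) z))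
  calc ‖A y‖ * ‖z‖ ≤ ‖A‖ * ‖y‖ * ‖z‖ := by gcongr; exact A.le_opNorm y
    _ ≤ ‖A‖ * c := by rw [mul_assoc]; gcongr

/-- The Gårding inequality: on the subspace where `‖ξ‖ ≤ h ‖ξ'‖`, for small `h`, the leading term
absorbs the other three. -/
theorem isEssentiallyCoercive_formOp (hT : 0 < T) {P : C(ℝ, Eu n →L[ℝ] Eu n)}
    (Q Q' R : C(ℝ, Eu n →L[ℝ] Eu n)) {p : ℝ} (hp0 : 0 < p)
    (hp : ∀ t ∈ Icc 0 T, ∀ v, p * ‖v‖ ^ 2 ≤ inner ℝ (P t v) v) :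
    IsEssentiallyCoercive (formOp T P Q Q' R) := by
  set C := ‖mulOp T Q‖ + ‖mulOp T Q'‖ + ‖mulOp T R‖ with hC
  have hC0 : 0 ≤ C := by positivity
  set h := p / (2 * (C + p)) with hh
  have hCh : (C + p) * h = p / 2 := by rw [hh]; field_simp
  have hh0 : 0 < h := by positivity
  have hh1 : h ≤ 1 := by nlinarith
  obtain ⟨K, hK, hpoincare⟩ := exists_finiteDimensional_norm_valL_le (n := n) hT hh0
  refine ⟨K, hK, p / 4, by positivity, fun ξ hξ => ?_⟩
  rw [inner_formOp, norm_sq_W12, inner_add_left, inner_add_left]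
  set u := valL T n ξ
  set w := derivL T n ξ
  have huw : ‖u‖ ≤ h * ‖w‖ := hpoincare ξ hξ
  have huw' : ‖u‖ ≤ ‖w‖ := huw.trans (mul_le_of_le_one_left (norm_nonneg _) hh1)
  have hmul : ‖u‖ * ‖w‖ ≤ h * ‖w‖ ^ 2 := by
    rw [sq, ← mul_assoc]
    gcongr
  have hP := mul_norm_sq_le_inner_mulOp hp w
  have hQ := neg_opNorm_mul_le_inner (mulOp T Q) hmul
  have hQ' := neg_opNorm_mul_le_inner (mulOp T Q') (mul_comm ‖w‖ ‖u‖ ▸ hmul)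
  have hR := neg_opNorm_mul_le_inner (mulOp T R) (y := u) (z := u)
    ((mul_le_mul_of_nonneg_left huw' (norm_nonneg u)).trans hmul)
  calc p / 4 * (‖u‖ ^ 2 + ‖w‖ ^ 2) ≤ p / 4 * (‖w‖ ^ 2 + ‖w‖ ^ 2) := by gcongr
    _ = p * ‖w‖ ^ 2 - (C + p) * h * ‖w‖ ^ 2 := by rw [hCh]; ring
    _ ≤ p * ‖w‖ ^ 2 - C * (h * ‖w‖ ^ 2) := by
        nlinarith [mul_nonneg (mul_nonneg hp0.le hh0.le) (sq_nonneg ‖w‖)]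
    _ ≤ _ := by rw [hC]; linarith

theorem exists_pos_forall_mul_norm_sq_le_inner {X E : Type*} [TopologicalSpace X]
    [NormedAddCommGroup E] [InnerProductSpace ℝ E] [FiniteDimensional ℝ E] {K : Set X}
    (hK : IsCompact K) {P : X → E →L[ℝ] E} (hP : Continuous P)
    (hpos : ∀ x v, v ≠ 0 → 0 < inner ℝ (P x v) v) :
    ∃ p > 0, ∀ x ∈ K, ∀ v, p * ‖v‖ ^ 2 ≤ inner ℝ (P x v) v := by
  have := FiniteDimensional.proper_real E
  obtain ⟨p, hp0, hp⟩ := (hK.prod (isCompact_sphere (0 : E) 1)).exists_forall_le'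
    (f := fun z => inner ℝ (P z.1 z.2) z.2) (a := 0) (by fun_prop)
    fun z hz => hpos z.1 z.2 (ne_zero_of_mem_unit_sphere ⟨z.2, hz.2⟩)
  refine ⟨p, hp0, fun x hx v => ?_⟩
  obtain rfl | hv := eq_or_ne v 0
  · simp
  have hunit := hp (x, ‖v‖⁻¹ • v) ⟨hx, by simp [norm_smul, hv]⟩
  simp only [map_smul, real_inner_smul_left, real_inner_smul_right] at hunit
  rwa [← mul_assoc, ← mul_inv, inv_mul_eq_div, ← sq, le_div_iff₀ (by positivity)] at hunit

end Garding

/-! ### Calculus of families of maps -/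

section Calculus

universe u

variable {E E' F G K : Type u} [NormedAddCommGroup E] [NormedSpace ℝ E]
  [NormedAddCommGroup E'] [NormedSpace ℝ E'] [NormedAddCommGroup F] [NormedSpace ℝ F]
  [NormedAddCommGroup G] [NormedSpace ℝ G] [NormedAddCommGroup K] [NormedSpace ℝ K]

theorem eventually_nhds_slice {X Y : Type*} [TopologicalSpace X] [TopologicalSpace Y]
    {p : X × Y} {P : X × Y → Prop} (h : ∀ᶠ z in 𝓝 p, P z) : ∀ᶠ y in 𝓝 p.2, P (p.1, y) :=
  (Continuous.prodMk_right p.1).continuousAt.eventually (p := P) h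

theorem continuousAt_iteratedFDeriv_zero_iff {h : ℝ → E → F} {z : ℝ × E} :
    ContinuousAt (fun w : ℝ × E => iteratedFDeriv ℝ 0 (h w.1) w.2) z ↔
      ContinuousAt (uncurry h) z :=
  (continuousMultilinearCurryFin0 ℝ E F).symm.toHomeomorph.comp_continuousAt_iff (uncurry h) z

theorem continuousAt_iteratedFDeriv_succ_iff {h : ℝ → E → F} {j : ℕ} {z : ℝ × E} :
    ContinuousAt (fun w : ℝ × E => iteratedFDeriv ℝ (j + 1) (h w.1) w.2) z ↔
      ContinuousAt (fun w : ℝ × E => iteratedFDeriv ℝ j (fderiv ℝ (h w.1)) w.2) z := by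
  simp only [iteratedFDeriv_succ_eq_comp_right]
  exact (continuousMultilinearCurryRightEquiv' ℝ j E F).symm.toHomeomorph.comp_continuousAt_iff
    (fun w : ℝ × E => iteratedFDeriv ℝ j (fderiv ℝ (h w.1)) w.2) z

theorem contDiffSndAt_zero {h : ℝ → E → F} {p : ℝ × E} :
    ContDiffSndAt 0 h p ↔ ∀ᶠ z in 𝓝 p, ContinuousAt (uncurry h) z := by
  constructor
  · exact fun H => H.mono fun z hz => continuousAt_iteratedFDeriv_zero_iff.mp (hz.2 0 le_rfl)
  · intro H
    filter_upwards [H.eventually_nhds] with z hz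
    refine ⟨?_, fun j hj => ?_⟩
    · rw [Nat.cast_zero, contDiffAt_zero]
      refine ⟨_, eventually_nhds_slice hz, fun x (hx : ContinuousAt (uncurry h) (z.1, x)) => ?_⟩
      exact (hx.comp (f := fun y => (z.1, y))
        (Continuous.prodMk_right z.1).continuousAt).continuousWithinAt
    · obtain rfl : j = 0 := Nat.le_zero.mp hj
      exact continuousAt_iteratedFDeriv_zero_iff.mpr hz.self_of_nhds

theorem contDiffSndAt_succ {r : ℕ} {h : ℝ → E → F} {p : ℝ × E} :
    ContDiffSndAt (r + 1) h p ↔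
      (∀ᶠ z in 𝓝 p, ContinuousAt (uncurry h) z ∧ DifferentiableAt ℝ (h z.1) z.2) ∧
      ContDiffSndAt r (fun t x => fderiv ℝ (h t) x) p := by
  constructor
  · intro H
    refine ⟨H.mono fun z hz => ⟨continuousAt_iteratedFDeriv_zero_iff.mp (hz.2 0 (Nat.zero_le _)),
      hz.1.differentiableAt (by simp)⟩, H.mono fun z hz => ⟨?_, fun j hj => ?_⟩⟩
    · exact hz.1.fderiv_right (by norm_cast)
    · exact continuousAt_iteratedFDeriv_succ_iff.mp (hz.2 (j + 1) (by lia))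
  · rintro ⟨hdiff, hderiv⟩
    filter_upwards [hdiff.eventually_nhds, hderiv] with z hz hz'
    refine ⟨?_, fun j hj => ?_⟩
    · rw [Nat.cast_add, Nat.cast_one]
      exact contDiffAt_succ_iff_hasFDerivAt.mpr ⟨fderiv ℝ (h z.1),
        ⟨_, eventually_nhds_slice hz, fun x hx => hx.2.hasFDerivAt⟩, hz'.1⟩
    · cases j with
      | zero => exact continuousAt_iteratedFDeriv_zero_iff.mpr hz.self_of_nhds.1
      | succ j => exact continuousAt_iteratedFDeriv_succ_iff.mpr (hz'.2 j (by lia))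

theorem ContDiffSndAt.eventually_continuousAt {r : ℕ} {h : ℝ → E → F} {p : ℝ × E}
    (H : ContDiffSndAt r h p) : ∀ᶠ z in 𝓝 p, ContinuousAt (uncurry h) z :=
  H.mono fun _ hz => continuousAt_iteratedFDeriv_zero_iff.mp (hz.2 0 (Nat.zero_le r))

theorem ContDiffSndAt.continuousAt {r : ℕ} {h : ℝ → E → F} {p : ℝ × E}
    (H : ContDiffSndAt r h p) : ContinuousAt (uncurry h) p :=
  H.eventually_continuousAt.self_of_nhds

theorem ContDiffSndAt.mono {r s : ℕ} (hs : s ≤ r) {h : ℝ → E → F} {p : ℝ × E}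
    (H : ContDiffSndAt r h p) : ContDiffSndAt s h p :=
  Eventually.mono H fun _ hz =>
    ⟨hz.1.of_le (by exact_mod_cast hs), fun j hj => hz.2 j (hj.trans hs)⟩

theorem ContDiffSndAt.congr {r : ℕ} {h h' : ℝ → E → F} {p : ℝ × E} (H : ContDiffSndAt r h p)
    (hh : ∀ᶠ z in 𝓝 p, h' z.1 z.2 = h z.1 z.2) : ContDiffSndAt r h' p := by
  filter_upwards [H, hh.eventually_nhds] with z hz hhz
  have eventuallyEq_slice : ∀ w : ℝ × E, (∀ᶠ y in 𝓝 w, h' y.1 y.2 = h y.1 y.2) →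
      h' w.1 =ᶠ[𝓝 w.2] h w.1 := fun w hw => eventually_nhds_slice hw
  refine ⟨hz.1.congr_of_eventuallyEq (eventuallyEq_slice z hhz), fun j hj => (hz.2 j hj).congr ?_⟩
  filter_upwards [hhz.eventually_nhds] with w hw
  exact ((eventuallyEq_slice w hw).symm.iteratedFDeriv ℝ j).self_of_nhds

theorem contDiffSndAt_const {r : ℕ} {g : ℝ → F} (hg : Continuous g) (p : ℝ × E) :
    ContDiffSndAt r (fun t (_ : E) => g t) p := by
  have hcont : ∀ z : ℝ × E, ContinuousAt (uncurry fun t (_ : E) => g t) z := fun z =>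
    (hg.comp continuous_fst).continuousAt
  induction r generalizing F with
  | zero => exact contDiffSndAt_zero.mpr (Eventually.of_forall hcont)
  | succ r ih =>
    refine contDiffSndAt_succ.mpr ⟨Eventually.of_forall fun z => ⟨hcont z, by fun_prop⟩, ?_⟩
    simp only [fderiv_fun_const, Pi.zero_apply]
    exact ih continuous_const fun z => continuousAt_const

theorem ContDiffSndAt.add {r : ℕ} {f g : ℝ → E → F} {p : ℝ × E} (hf : ContDiffSndAt r f p)
    (hg : ContDiffSndAt r g p) : ContDiffSndAt r (fun t x => f t x + g t x) p := by
  induction r generalizing F with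
  | zero =>
    rw [contDiffSndAt_zero] at *
    filter_upwards [hf, hg] with z hfz hgz using hfz.add hgz
  | succ r ih =>
    rw [contDiffSndAt_succ] at *
    refine ⟨?_, (ih hf.2 hg.2).congr ?_⟩
    · filter_upwards [hf.1, hg.1] with z hfz hgz using ⟨hfz.1.add hgz.1, hfz.2.add hgz.2⟩
    · filter_upwards [hf.1, hg.1] with z hfz hgz using fderiv_fun_add hfz.2 hgz.2

theorem ContDiffSndAt.bilinear {r : ℕ} (β : F →L[ℝ] G →L[ℝ] K) {f : ℝ → E → F} {g : ℝ → E → G}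
    {p : ℝ × E} (hf : ContDiffSndAt r f p) (hg : ContDiffSndAt r g p) :
    ContDiffSndAt r (fun t x => β (f t x) (g t x)) p := by
  induction r generalizing F G K with
  | zero =>
    rw [contDiffSndAt_zero] at *
    filter_upwards [hf, hg] with z hfz hgz using
      β.continuous₂.continuousAt.comp (hfz.prodMk hgz)
  | succ r ih =>
    have hf' := contDiffSndAt_succ.mp hf
    have hg' := contDiffSndAt_succ.mp hg
    have hprod : ∀ᶠ z in 𝓝 p, HasFDerivAt (fun x => β (f z.1 x) (g z.1 x))
        (β.precompR E (f z.1 z.2) (fderiv ℝ (g z.1) z.2)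
          + β.precompL E (fderiv ℝ (f z.1) z.2) (g z.1 z.2)) z.2 := by
      filter_upwards [hf'.1, hg'.1] with z hfz hgz
      exact β.hasFDerivAt_of_bilinear hfz.2.hasFDerivAt hgz.2.hasFDerivAt
    refine contDiffSndAt_succ.mpr ⟨?_, ((ih (β.precompR E) (hf.mono r.le_succ) hg'.2).add
      (ih (β.precompL E) hf'.2 (hg.mono r.le_succ))).congr (hprod.mono fun z hz => hz.fderiv)⟩
    filter_upwards [hf'.1, hg'.1, hprod] with z hfz hgz hz
    exact ⟨β.continuous₂.continuousAt.comp (hfz.1.prodMk hgz.1), hz.differentiableAt⟩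

theorem ContDiffSndAt.comp_linear {r : ℕ} {h : ℝ → E → F} {Λ : ℝ → E' →L[ℝ] E} (hΛ : Continuous Λ)
    {p : ℝ × E'} (H : ContDiffSndAt r h (p.1, Λ p.1 p.2)) :
    ContDiffSndAt r (fun t x => h t (Λ t x)) p := by
  have hcont : Continuous fun z : ℝ × E' => (z.1, Λ z.1 z.2) := by fun_prop
  have continuousAt_comp : ∀ {z : ℝ × E'}, ContinuousAt (uncurry h) (z.1, Λ z.1 z.2) →
      ContinuousAt (uncurry fun t x => h t (Λ t x)) z := fun {z} hz =>
    hz.comp (f := fun z : ℝ × E' => (z.1, Λ z.1 z.2)) hcont.continuousAt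
  induction r generalizing F with
  | zero =>
    rw [contDiffSndAt_zero] at *
    filter_upwards [hcont.continuousAt.eventually H] with z hz using continuousAt_comp hz
  | succ r ih =>
    rw [contDiffSndAt_succ] at *
    have hchain := hcont.continuousAt.eventually H.1
    refine ⟨?_, (ContDiffSndAt.bilinear (ContinuousLinearMap.compL ℝ E' E F) (ih H.2 ?_)
      (contDiffSndAt_const hΛ p)).congr ?_⟩
    · filter_upwards [hchain] with z hz
      exact ⟨continuousAt_comp hz.1, hz.2.comp z.2 (Λ z.1).differentiableAt⟩
    · exact fun {z} hz => hz.comp (f := fun z : ℝ × E' => (z.1, Λ z.1 z.2)) hcont.continuousAt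
    · filter_upwards [hchain] with z hz
      exact (hz.2.hasFDerivAt.comp z.2 (Λ z.1).hasFDerivAt).fderiv

theorem contDiffSndAt_linear {r : ℕ} {Λ : ℝ → E →L[ℝ] F} (hΛ : Continuous Λ) (p : ℝ × E) :
    ContDiffSndAt r (fun t x => Λ t x) p := by
  have hcont : Continuous (uncurry fun t x => Λ t x) := by fun_prop
  cases r with
  | zero => exact contDiffSndAt_zero.mpr (Eventually.of_forall fun _ => hcont.continuousAt)
  | succ r =>
    exact contDiffSndAt_succ.mpr
      ⟨Eventually.of_forall fun z => ⟨hcont.continuousAt, (Λ z.1).differentiableAt⟩,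
        (contDiffSndAt_const hΛ p).congr (Eventually.of_forall fun z => (Λ z.1).fderiv)⟩

theorem hasFDerivAt_comp_prodMk {h : E → F} {t : ℝ} {x : E} (hh : DifferentiableAt ℝ h x)
    {ℓ : ℝ × F → G} (hℓ : DifferentiableAt ℝ ℓ (t, h x)) :
    HasFDerivAt (fun y => ℓ (t, h y))
      (((fderiv ℝ ℓ (t, h x)).comp (ContinuousLinearMap.inr ℝ ℝ F)).comp (fderiv ℝ h x)) x :=
  (hℓ.hasFDerivAt.comp (h x) (hasFDerivAt_prodMk_right t (h x))).comp x hh.hasFDerivAt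

theorem ContDiffSndAt.comp_left {r : ℕ} {h : ℝ → E → F} {p : ℝ × E} (H : ContDiffSndAt r h p)
    {ℓ : ℝ × F → G} (hℓ : ContDiffAt ℝ r ℓ (p.1, h p.1 p.2)) :
    ContDiffSndAt r (fun t x => ℓ (t, h t x)) p := by
  have continuousAt_graph : ∀ {z : ℝ × E}, ContinuousAt (uncurry h) z →
      ContinuousAt (fun z : ℝ × E => (z.1, h z.1 z.2)) z := fun hz => continuousAt_fst.prodMk hz
  induction r generalizing G with
  | zero =>
    have hℓz := (continuousAt_graph H.continuousAt).eventually (hℓ.eventually (by simp))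
    rw [contDiffSndAt_zero] at *
    filter_upwards [H, hℓz] with z hz hℓz using
      hℓz.continuousAt.comp (f := fun z : ℝ × E => (z.1, h z.1 z.2)) (continuousAt_graph hz)
  | succ r ih =>
    have hℓz := (continuousAt_graph H.continuousAt).eventually (hℓ.eventually (by simp))
    have H' := contDiffSndAt_succ.mp H
    have hℓ' : ContDiffAt ℝ r (fun z => (fderiv ℝ ℓ z).comp (ContinuousLinearMap.inr ℝ ℝ F))
        (p.1, h p.1 p.2) :=
      (hℓ.fderiv_right (m := r) (by norm_cast)).clm_comp contDiffAt_const
    refine contDiffSndAt_succ.mpr ⟨?_, (ContDiffSndAt.bilinear (ContinuousLinearMap.compL ℝ E F G)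
      (ih (H.mono r.le_succ) hℓ') H'.2).congr ?_⟩
    · filter_upwards [H'.1, hℓz] with z hz hℓz
      exact ⟨hℓz.continuousAt.comp (f := fun z : ℝ × E => (z.1, h z.1 z.2))
          (continuousAt_graph hz.1),
        (hasFDerivAt_comp_prodMk hz.2 (hℓz.differentiableAt (by simp))).differentiableAt⟩
    · filter_upwards [H'.1, hℓz] with z hz hℓz
      exact (hasFDerivAt_comp_prodMk hz.2 (hℓz.differentiableAt (by simp))).fderiv

theorem ContDiffSndAt.clm_left {r : ℕ} {h : ℝ → E → F} {p : ℝ × E} (H : ContDiffSndAt r h p)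
    (A : F →L[ℝ] G) : ContDiffSndAt r (fun t x => A (h t x)) p :=
  H.comp_left (ℓ := fun z => A z.2) (A.contDiff.comp contDiff_snd).contDiffAt

theorem ContDiffSndAt.prodMk {r : ℕ} {f : ℝ → E → F} {g : ℝ → E → G} {p : ℝ × E}
    (hf : ContDiffSndAt r f p) (hg : ContDiffSndAt r g p) :
    ContDiffSndAt r (fun t x => (f t x, g t x)) p :=
  ((hf.clm_left (ContinuousLinearMap.inl ℝ F G)).add
    (hg.clm_left (ContinuousLinearMap.inr ℝ F G))).congr (Eventually.of_forall fun z => by simp)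

end Calculus

/-! ### Families of maps into a manifold, in charts -/

section Charts

variable {n : ℕ} {M : Type*} [TopologicalSpace M] [ChartedSpace (Eu n) M]
  {E : Type} [NormedAddCommGroup E] [NormedSpace ℝ E]

section

variable {r s : ℕ} {f : ℝ → E → M} {U : Set E}

theorem IsFamily.continuousAt (hf : IsFamily n r s f U) (hU : IsOpen U) {t : ℝ} {q : E}
    (hq : q ∈ U) : ContinuousAt (uncurry f) (t, q) :=
  hf.cont.continuousAt ((isOpen_univ.prod hU).mem_nhds ⟨mem_univ t, hq⟩)

theorem IsFamily.eventually_mem_source (hf : IsFamily n r s f U) (hU : IsOpen U) {t : ℝ} {q : E}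
    (hq : q ∈ U) : ∀ᶠ z in 𝓝 (t, q), f z.1 z.2 ∈ (chartAt (Eu n) (f t q)).source :=
  (hf.continuousAt hU hq).eventually
    ((chartAt (Eu n) (f t q)).open_source.mem_nhds (mem_chart_source _ _))

theorem IsFamily.hasFDerivAt_localRep (hf : IsFamily n r s f U) (hr : 1 ≤ r) {t : ℝ} {q : E}
    (hq : q ∈ U) :
    ∀ᶠ z in 𝓝 (t, q), HasFDerivAt (uncurry (localRep n f t q))
      ((ContinuousLinearMap.toSpanSingleton ℝ
        (deriv (fun t' => localRep n f t q t' z.2) z.1)).coprod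
        (fderiv ℝ (localRep n f t q z.1) z.2)) z := by
  obtain ⟨hspace, hspace'⟩ := contDiffSndAt_succ.mp ((hf.space t q hq).mono hr)
  filter_upwards [hspace.eventually_nhds, hspace'.eventually_continuousAt,
    (hf.time t q hq).eventually_continuousAt, (hf.diff t q hq).eventually_nhds]
    with z hspace hspace' htime' htime
  refine (hasStrictFDerivAt_uncurry_coprod (f := localRep n f t q)
    (f₁ := fun t' x => ContinuousLinearMap.toSpanSingleton ℝ
        (deriv (fun t'' => localRep n f t q t'' x) t'))
    (f₂ := fun t' x => fderiv ℝ (localRep n f t q t') x) ?_ ?_ ?_ hspace').hasFDerivAt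
  · exact htime.mono fun w hw => hw.hasDerivAt.hasFDerivAt
  · exact hspace.mono fun w hw => hw.2.hasFDerivAt
  · exact (ContinuousLinearMap.toSpanSingletonCLE (𝕜 := ℝ)
      (E := Eu n)).continuous.continuousAt.comp htime'

theorem IsFamily.mdifferentiableAt (hf : IsFamily n r s f U) (hU : IsOpen U) (hr : 1 ≤ r) {t : ℝ}
    {q : E} (hq : q ∈ U) : MDifferentiableAt 𝓘(ℝ, ℝ × E) (𝓡 n) (uncurry f) (t, q) :=
  (mdifferentiableAt_iff (uncurry f) (t, q)).mpr ⟨hf.continuousAt hU hq,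
    DifferentiableAt.differentiableWithinAt
      (hf.hasFDerivAt_localRep hr (t := t) hq).self_of_nhds.differentiableAt⟩

end

variable [IsManifold (𝓡 n) 1 M]

theorem IsFamily.mfderiv_chart_apply {r s : ℕ} {f : ℝ → E → M} {U : Set E}
    (hf : IsFamily n r s f U) (hU : IsOpen U) (hr : 1 ≤ r) {t : ℝ} {q : E} (hq : q ∈ U) :
    ∀ᶠ z in 𝓝 (t, q), ∀ (c : ℝ) (v : E),
      mfderiv (𝓡 n) 𝓘(ℝ, Eu n) (extChartAt (𝓡 n) (f t q)) (f z.1 z.2)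
        (mfderiv 𝓘(ℝ, ℝ × E) (𝓡 n) (uncurry f) z ((c, v) : ℝ × E)) =
        c • deriv (fun t' => localRep n f t q t' z.2) z.1
          + fderiv ℝ (localRep n f t q z.1) z.2 v := by
  have hmem : ∀ᶠ z : ℝ × E in 𝓝 (t, q), z.2 ∈ U :=
    continuousAt_snd.eventually (hU.mem_nhds hq)
  filter_upwards [hf.hasFDerivAt_localRep hr hq, hf.eventually_mem_source hU hq, hmem]
    with z hderiv hsource hz c v
  have hchain := mfderiv_comp z (mdifferentiableAt_extChartAt hsource)
    (hf.mdifferentiableAt (t := z.1) hU hr hz)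
  have hlocal : mfderiv 𝓘(ℝ, ℝ × E) 𝓘(ℝ, Eu n) (extChartAt (𝓡 n) (f t q) ∘ uncurry f) z =
      (ContinuousLinearMap.toSpanSingleton ℝ
        (deriv (fun t' => localRep n f t q t' z.2) z.1)).coprod
        (fderiv ℝ (localRep n f t q z.1) z.2) :=
    mfderiv_eq_fderiv.trans hderiv.fderiv
  have happly := congrArg (fun A : ℝ × E →L[ℝ] Eu n => A (c, v)) (hchain.symm.trans hlocal)
  exact happly.trans (by simp)

theorem extChartAt_tangentBundle_apply (t₀ t : ℝ) (z₀ : TangentBundle (𝓡 n) M) {x : M}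
    (hx : x ∈ (chartAt (Eu n) z₀.proj).source) (v : TangentSpace (𝓡 n) x) :
    extChartAt (𝓘(ℝ, ℝ).prod (𝓡 n).tangent) (t₀, z₀) (t, (⟨x, v⟩ : TangentBundle (𝓡 n) M)) =
      (t, (extChartAt (𝓡 n) z₀.proj x,
        mfderiv (𝓡 n) 𝓘(ℝ, Eu n) (extChartAt (𝓡 n) z₀.proj) x v)) := by
  have hbase : x ∈ (trivializationAt (Eu n) (TangentSpace (𝓡 n)) z₀.proj).baseSet := hx
  rw [← TangentBundle.continuousLinearMapAt_trivializationAt hx, extChartAt_prod]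
  refine Prod.ext rfl ?_
  change extChartAt ((𝓡 n).prod 𝓘(ℝ, Eu n)) z₀ ⟨x, v⟩ = _
  rw [FiberBundle.extChartAt]
  refine Prod.ext ?_ ?_
  · change extChartAt (𝓡 n) z₀.proj
      ((trivializationAt (Eu n) (TangentSpace (𝓡 n)) z₀.proj) ⟨x, v⟩).1 = _
    rw [Bundle.Trivialization.coe_fst' _ hbase]
  · exact (congrFun (Bundle.Trivialization.coe_linearMapAt_of_mem (R := ℝ) _ hbase) v).symm

end Charts

/-! ### The pulled-back Lagrangian -/

section Pullback

variable {n : ℕ} {M : Type*} [TopologicalSpace M] [ChartedSpace (Eu n) M]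
  {E E' : Type} [NormedAddCommGroup E] [NormedSpace ℝ E]
  [NormedAddCommGroup E'] [NormedSpace ℝ E']
  {r s : ℕ} {f : ℝ → E → M} {U : Set E}

theorem IsFamily.mono {r' s' : ℕ} (hf : IsFamily n r s f U) (hr : r' ≤ r) (hs : s' ≤ s) :
    IsFamily n r' s' f U where
  cont := hf.cont
  space t q hq := (hf.space t q hq).mono hr
  diff := hf.diff
  time t q hq := (hf.time t q hq).mono hs

theorem IsFamily.comp_linear (hf : IsFamily n (r + 1) r f U) {Λ Λ' : ℝ → E' →L[ℝ] E}
    (hΛ : ∀ t, HasDerivAt Λ (Λ' t) t) (hΛ' : Continuous Λ') {U' : Set E'}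
    (hmaps : ∀ t, MapsTo (Λ t) U' U) :
    IsFamily n (r + 1) r (fun t x => f t (Λ t x)) U' := by
  have hcont : Continuous Λ := continuous_iff_continuousAt.mpr fun t => (hΛ t).continuousAt
  have hgraph : Continuous fun z : ℝ × E' => (z.1, Λ z.1 z.2) := by fun_prop
  have hderiv : ∀ t, ∀ x ∈ U', ∀ᶠ z : ℝ × E' in 𝓝 (t, x),
      HasDerivAt (fun t' => localRep n f t (Λ t x) t' (Λ t' z.2))
        (deriv (fun t' => localRep n f t (Λ t x) t' (Λ z.1 z.2)) z.1 +
          fderiv ℝ (localRep n f t (Λ t x) z.1) (Λ z.1 z.2) (Λ' z.1 z.2)) z.1 := by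
    intro t x hx
    filter_upwards [hgraph.continuousAt.eventually
      (hf.hasFDerivAt_localRep (t := t) (by lia) (hmaps t hx))] with z hz
    have hcurve : HasDerivAt (fun t' => (t', Λ t' z.2)) ((1 : ℝ), Λ' z.1 z.2) z.1 :=
      (hasDerivAt_id z.1).prodMk
        ((ContinuousLinearMap.apply ℝ E z.2).hasFDerivAt.comp_hasDerivAt z.1 (hΛ z.1))
    refine (hz.comp_hasDerivAt z.1 hcurve).congr_deriv ?_
    simp
  refine ⟨hf.cont.comp hgraph.continuousOn fun z hz => ⟨mem_univ _, hmaps z.1 hz.2⟩,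
    fun t x hx => ContDiffSndAt.comp_linear hcont (p := (t, x)) (hf.space t _ (hmaps t hx)),
    fun t x hx => (hderiv t x hx).mono fun z hz => hz.differentiableAt, fun t x hx => ?_⟩
  have htime := ContDiffSndAt.comp_linear hcont (p := (t, x)) (hf.time t _ (hmaps t hx))
  have hspace := ContDiffSndAt.comp_linear hcont (p := (t, x))
    (contDiffSndAt_succ.mp (hf.space t _ (hmaps t hx))).2
  exact (htime.add (hspace.bilinear (ContinuousLinearMap.id ℝ (E →L[ℝ] Eu n))
    (contDiffSndAt_linear hΛ' (t, x)))).congr ((hderiv t x hx).mono fun z hz => hz.deriv)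

theorem isFamily_smul_loop {T : ℝ} {φ : ℝ → Eu n → M} {U : Set (Eu n)}
    (hφ : IsFamily n (r + 1) r φ U) (η : C1 T n) {I : Set ℝ}
    (hI : ∀ s ∈ I, ∀ t, s • η.1.1 t ∈ U) :
    IsFamily n (r + 1) r (fun t s => φ t (s • η.1.1 t)) I :=
  hφ.comp_linear (Λ := fun t => ContinuousLinearMap.toSpanSingleton ℝ (η.1.1 t))
    (fun t => (ContinuousLinearMap.toSpanSingletonCLE (𝕜 := ℝ)
      (E := Eu n)).hasFDerivAt.comp_hasDerivAt t (η.2.2 t))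
    ((ContinuousLinearMap.toSpanSingletonCLE (𝕜 := ℝ) (E := Eu n)).continuous.comp
      η.1.2.continuous) fun t s hs => hI s hs t

theorem mfderiv_curve (hf : IsFamily n r s f U) (hU : IsOpen U) (hr : 1 ≤ r) {q : ℝ → E} {q' : E}
    {t : ℝ} (hq : HasDerivAt q q' t) (hmem : q t ∈ U) :
    mfderiv 𝓘(ℝ, ℝ) (𝓡 n) (fun t' => f t' (q t')) t (1 : ℝ) =
      mfderiv 𝓘(ℝ, ℝ × E) (𝓡 n) (uncurry f) (t, q t) ((1, q') : ℝ × E) := by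
  have hgraph : HasMFDerivAt 𝓘(ℝ, ℝ) 𝓘(ℝ, ℝ × E) (fun t' => (t', q t')) t
      ((ContinuousLinearMap.id ℝ ℝ).prod (ContinuousLinearMap.toSpanSingleton ℝ q')) :=
    ((hasFDerivAt_id t).prodMk hq.hasFDerivAt).hasMFDerivAt
  have hchain := (HasMFDerivAt.comp t (f := fun t' => (t', q t'))
    (hf.mdifferentiableAt hU hr hmem).hasMFDerivAt hgraph).mfderiv
  refine (congrArg (fun A : ℝ →L[ℝ] Eu n => A 1) hchain).trans ?_
  change (mfderiv 𝓘(ℝ, ℝ × E) (𝓡 n) (uncurry f) (t, q t) : ℝ × E →L[ℝ] Eu n)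
    ((1 : ℝ), (1 : ℝ) • q') = _
  rw [one_smul]

theorem mfderiv_slice (hf : IsFamily n r s f U) (hU : IsOpen U) (hr : 1 ≤ r) {q : E} (hq : q ∈ U)
    (t : ℝ) (v : E) :
    mfderiv 𝓘(ℝ, E) (𝓡 n) (f t) q v =
      mfderiv 𝓘(ℝ, ℝ × E) (𝓡 n) (uncurry f) (t, q) ((0, v) : ℝ × E) := by
  have hslice : HasMFDerivAt 𝓘(ℝ, E) 𝓘(ℝ, ℝ × E) (fun x => (t, x)) q
      (ContinuousLinearMap.inr ℝ ℝ E) := (hasFDerivAt_prodMk_right t q).hasMFDerivAt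
  exact congrArg (fun A : E →L[ℝ] Eu n => A v) (HasMFDerivAt.comp q (f := fun x => (t, x))
    (hf.mdifferentiableAt hU hr hq).hasMFDerivAt hslice).mfderiv

/-- The curve `t' ↦ f t' (q + (t' - t) v)` through `f t q`, where `z = (q, v)`, has this velocity
in `TM` at the time `t`; thus `pullback L f t q v = L (t, velocity n f t (q, v))`. -/
def velocity (n : ℕ) {M : Type*} [TopologicalSpace M] [ChartedSpace (Eu n) M]
    (f : ℝ → E → M) (t : ℝ) (z : E × E) : TangentBundle (𝓡 n) M :=
  ⟨f t z.1, mfderiv 𝓘(ℝ, ℝ × E) (𝓡 n) (uncurry f) (t, z.1) ((1, z.2) : ℝ × E)⟩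

theorem velocity_add_period {T : ℝ} (hf : IsFamily n r s f U) (hU : IsOpen U) (hr : 1 ≤ r)
    (hper : ∀ t, ∀ q ∈ U, f (t + T) q = f t q) {z : E × E} (hz : z.1 ∈ U) (t : ℝ) :
    velocity n f (t + T) z = velocity n f t z := by
  have hshift : HasMFDerivAt 𝓘(ℝ, ℝ × E) 𝓘(ℝ, ℝ × E) (fun w : ℝ × E => (w.1 + T, w.2)) (t, z.1)
      ((ContinuousLinearMap.fst ℝ ℝ E).prod (ContinuousLinearMap.snd ℝ ℝ E)) :=
    ((hasFDerivAt_fst.add_const T).prodMk hasFDerivAt_snd).hasMFDerivAt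
  have hcomp := HasMFDerivAt.comp (t, z.1) (f := fun w : ℝ × E => (w.1 + T, w.2))
    (hf.mdifferentiableAt hU hr (t := t + T) hz).hasMFDerivAt hshift
  have hperiod : uncurry f =ᶠ[𝓝 (t, z.1)] uncurry f ∘ fun w : ℝ × E => (w.1 + T, w.2) := by
    filter_upwards [continuousAt_snd.eventually (hU.mem_nhds hz)] with w hw
      using (hper w.1 w.2 hw).symm
  have hfiber := congrArg (fun A : ℝ × E →L[ℝ] Eu n => A (1, z.2))
    (hcomp.congr_of_eventuallyEq hperiod).mfderiv
  refine Bundle.TotalSpace.ext (hper t z.1 hz) (heq_of_eq hfiber.symm)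

/-- `velocity f` in the chart of `TM` induced by the preferred chart of `M` at `f t₀ q₀`. -/
def velocityRep (n : ℕ) {M : Type*} [TopologicalSpace M] [ChartedSpace (Eu n) M]
    (f : ℝ → E → M) (t₀ : ℝ) (q₀ : E) (t : ℝ) (z : E × E) : Eu n × Eu n :=
  (localRep n f t₀ q₀ t z.1, deriv (fun t' => localRep n f t₀ q₀ t' z.1) t +
    fderiv ℝ (localRep n f t₀ q₀ t) z.1 z.2)

theorem contDiffSndAt_velocityRep (hf : IsFamily n (r + 1) r f U) {q : E} (hq : q ∈ U) (t : ℝ)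
    (v : E) : ContDiffSndAt r (velocityRep n f t q) (t, (q, v)) := by
  have hfst : Continuous fun _ : ℝ => ContinuousLinearMap.fst ℝ E E := continuous_const
  have hsnd : Continuous fun _ : ℝ => ContinuousLinearMap.snd ℝ E E := continuous_const
  have hspace := hf.space t q hq
  refine ((hspace.mono r.le_succ).comp_linear hfst (p := (t, (q, v)))).prodMk
    (((hf.time t q hq).comp_linear hfst (p := (t, (q, v)))).add ?_)
  exact (ContDiffSndAt.comp_linear hfst (p := (t, (q, v)))
    (contDiffSndAt_succ.mp hspace).2).bilinear (ContinuousLinearMap.id ℝ (E →L[ℝ] Eu n))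
    (contDiffSndAt_linear hsnd (t, (q, v)))

theorem action_eq_pulledAction {T : ℝ} {L : ℝ × TangentBundle (𝓡 n) M → ℝ} {φ : ℝ → Eu n → M}
    {U : Set (Eu n)} (hφ : IsFamily n r s φ U) (hU : IsOpen U) (hr : 1 ≤ r) (ξ : C1 T n)
    (hξ : ∀ t, ξ.1.1 t ∈ U) : action T L (fun t => φ t (ξ.1.1 t)) = pulledAction T L φ ξ := by
  refine intervalIntegral.integral_congr fun t _ => ?_
  beta_reduce
  rw [pullback, mfderiv_curve hφ hU hr (ξ.2.2 t) (hξ t)]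

variable [IsManifold (𝓡 n) 1 M]

theorem eventually_extChartAt_velocity (hf : IsFamily n r s f U) (hU : IsOpen U) (hr : 1 ≤ r)
    {q : E} (hq : q ∈ U) (t : ℝ) (v : E) :
    ∀ᶠ z : ℝ × (E × E) in 𝓝 (t, (q, v)),
      (z.1, velocity n f z.1 z.2) ∈
        (extChartAt (𝓘(ℝ, ℝ).prod (𝓡 n).tangent) (t, velocity n f t (q, v))).source ∧
      extChartAt (𝓘(ℝ, ℝ).prod (𝓡 n).tangent) (t, velocity n f t (q, v))
        (z.1, velocity n f z.1 z.2) = (z.1, velocityRep n f t q z.1 z.2) := by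
  have hbase : ContinuousAt (fun z : ℝ × (E × E) => (z.1, z.2.1)) (t, (q, v)) := by fun_prop
  filter_upwards [hbase.eventually (hf.eventually_mem_source hU hq),
    hbase.eventually (hf.mfderiv_chart_apply hU hr hq)] with z hsource hfiber
  constructor
  · rw [extChartAt_source]
    exact ⟨mem_univ _, (TangentBundle.mem_chart_source_iff _ _).mpr hsource⟩
  · refine (extChartAt_tangentBundle_apply t z.1 (velocity n f t (q, v)) hsource _).trans ?_
    exact Prod.ext rfl (Prod.ext rfl ((hfiber 1 z.2.2).trans (by rw [one_smul]; rfl)))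

theorem contDiffSndAt_comp_velocity {L : ℝ × TangentBundle (𝓡 n) M → ℝ}
    (hL : ContMDiff (𝓘(ℝ, ℝ).prod (𝓡 n).tangent) 𝓘(ℝ, ℝ) r L)
    (hf : IsFamily n (r + 1) r f U) (hU : IsOpen U) {q : E} (hq : q ∈ U) (t : ℝ) (v : E) :
    ContDiffSndAt r (fun t z => L (t, velocity n f t z)) (t, (q, v)) := by
  set e := extChartAt (𝓘(ℝ, ℝ).prod (𝓡 n).tangent) (t, velocity n f t (q, v))
  have hchart := eventually_extChartAt_velocity hf hU (by lia) hq t v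
  have hlocal : ContDiffAt ℝ r (L ∘ e.symm) (t, velocityRep n f t q t (q, v)) := by
    have hLe := (contMDiffAt_iff.mp (hL (t, velocity n f t (q, v)))).2
    rw [ModelWithCorners.range_eq_univ, contDiffWithinAt_univ, hchart.self_of_nhds.2] at hLe
    exact hLe
  refine ((contDiffSndAt_velocityRep hf hq t v).comp_left hlocal).congr ?_
  filter_upwards [hchart] with z hz
  rw [← hz.2, comp_apply, e.left_inv hz.1]

end Pullback

/-! ### Differentiability of integral functionals on `C¹(S_T, ℝⁿ)` -/

section Taylor

variable {E F : Type} [NormedAddCommGroup E] [NormedSpace ℝ E]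
  [NormedAddCommGroup F] [NormedSpace ℝ F]

theorem continuous_comp_of_contDiffSndAt {r : ℕ} {g : ℝ → E → F} {u : ℝ → E} (hu : Continuous u)
    (hg : ∀ t, ContDiffSndAt r g (t, u t)) : Continuous fun t => g t (u t) :=
  continuous_iff_continuousAt.mpr fun t => ContinuousAt.comp (g := uncurry g)
    (f := fun t => (t, u t)) (hg t).continuousAt (continuous_id.prodMk hu).continuousAt

theorem eventually_forall_norm_fderiv_sub_le {g : ℝ → E → F} {u : ℝ → E} (hu : Continuous u)
    (hg : ∀ t, ContDiffSndAt 1 g (t, u t)) {K : Set ℝ} (hK : IsCompact K) {ε : ℝ} (hε : 0 < ε) :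
    ∀ᶠ h : E in 𝓝 0, ∀ t ∈ K, DifferentiableAt ℝ (g t) (u t + h) ∧
      ‖fderiv ℝ (g t) (u t + h) - fderiv ℝ (g t) (u t)‖ ≤ ε := by
  refine hK.eventually_forall_of_forall_eventually fun t _ => ?_
  obtain ⟨hdiff, hfderiv⟩ := contDiffSndAt_succ.mp (hg t)
  have hshift : Tendsto (fun z : E × ℝ => (z.2, u z.2 + z.1)) (𝓝 (0, t)) (𝓝 (t, u t)) :=
    Continuous.tendsto' (by fun_prop) _ _ (by simp)
  have hcurve : Tendsto (fun z : E × ℝ => (z.2, u z.2)) (𝓝 (0, t)) (𝓝 (t, u t)) :=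
    Continuous.tendsto' (by fun_prop) _ _ rfl
  have hcont : Tendsto (uncurry fun t x => fderiv ℝ (g t) x) (𝓝 (t, u t))
      (𝓝 (fderiv ℝ (g t) (u t))) := hfderiv.continuousAt
  filter_upwards [hshift.eventually hdiff,
    ((hcont.comp hshift).sub (hcont.comp hcurve)).norm.eventually_le_const
      (by simpa only [sub_self, norm_zero] using hε)] with z hzdiff hzsub
    using ⟨hzdiff.2, hzsub⟩

theorem exists_forall_norm_taylor_sub_le {g : ℝ → E → F} {u : ℝ → E} (hu : Continuous u)
    (hg : ∀ t, ContDiffSndAt 1 g (t, u t)) {K : Set ℝ} (hK : IsCompact K) {ε : ℝ} (hε : 0 < ε) :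
    ∃ δ > 0, ∀ t ∈ K, ∀ h, ‖h‖ < δ →
      ‖g t (u t + h) - g t (u t) - fderiv ℝ (g t) (u t) h‖ ≤ ε * ‖h‖ := by
  obtain ⟨δ, hδ, hball⟩ :=
    Metric.eventually_nhds_iff.mp (eventually_forall_norm_fderiv_sub_le hu hg hK hε)
  refine ⟨δ, hδ, fun t ht h hh => ?_⟩
  have hmem : ∀ x ∈ Metric.ball (u t) δ, DifferentiableAt ℝ (g t) x ∧
      ‖fderiv ℝ (g t) x - fderiv ℝ (g t) (u t)‖ ≤ ε := by
    intro x hx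
    simpa only [add_sub_cancel] using
      hball (y := x - u t) (by simpa [dist_eq_norm] using hx) t ht
  simpa only [add_sub_cancel_left] using
    (convex_ball (u t) δ).norm_image_sub_le_of_norm_hasFDerivWithin_le'
      (fun x hx => (hmem x hx).1.hasFDerivAt.hasFDerivWithinAt) (fun x hx => (hmem x hx).2)
      (Metric.mem_ball_self hδ) (show u t + h ∈ Metric.ball (u t) δ by simpa using hh)

end Taylor

section Functional

variable {T : ℝ} {n : ℕ}

/-- The 1-jet `(ξ(t), ξ'(t))` of a loop at the time `t`. -/
def jet (t : ℝ) : C1 T n →L[ℝ] Eu n × Eu n :=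
  ((BoundedContinuousFunction.evalCLM ℝ t).prodMap (BoundedContinuousFunction.evalCLM ℝ t)).comp
    (C1 T n).subtypeL

theorem continuous_jet (ξ : C1 T n) : Continuous fun t => jet t ξ :=
  ξ.1.1.continuous.prodMk ξ.1.2.continuous

theorem norm_jet_le (t : ℝ) (ξ : C1 T n) : ‖jet t ξ‖ ≤ ‖ξ‖ :=
  max_le ((ξ.1.1.norm_coe_le_norm t).trans (norm_fst_le ξ.1))
    ((ξ.1.2.norm_coe_le_norm t).trans (norm_snd_le ξ.1))

theorem norm_integral_le_mul (hT : 0 ≤ T) {f : ℝ → ℝ} {C : ℝ} (h : ∀ t ∈ Icc 0 T, ‖f t‖ ≤ C) :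
    ‖∫ t in (0 : ℝ)..T, f t‖ ≤ C * T := by
  simpa only [sub_zero, abs_of_nonneg hT] using
    intervalIntegral.norm_integral_le_of_norm_le_const (a := 0) (b := T) fun t ht =>
      h t (Ioc_subset_Icc_self (uIoc_of_le hT ▸ ht))

/-- The linear functional `η ↦ ∫₀ᵀ A(t) (η, η') dt`, as a linear function of `A`. -/
def firstVariation (hT : 0 ≤ T) : C(ℝ, Eu n × Eu n →L[ℝ] ℝ) →ₗ[ℝ] C1 T n →L[ℝ] ℝ :=
  have hInt (A : C(ℝ, Eu n × Eu n →L[ℝ] ℝ)) (η : C1 T n) :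
      IntervalIntegrable (fun t => A t (jet t η)) volume 0 T :=
    (A.continuous.clm_apply (continuous_jet η)).intervalIntegrable _ _
  have hbound (A : C(ℝ, Eu n × Eu n →L[ℝ] ℝ)) :
      ∃ C, ∀ η : C1 T n, ‖∫ t in (0 : ℝ)..T, A t (jet t η)‖ ≤ C * ‖η‖ := by
    obtain ⟨C, hC⟩ := (isCompact_Icc (a := 0) (b := T)).exists_bound_of_continuousOn
      A.continuous.continuousOn
    refine ⟨C * T, fun η => ?_⟩
    rw [mul_right_comm]
    exact norm_integral_le_mul hT fun t ht =>
      (A t).le_of_opNorm_le_of_le (hC t ht) (norm_jet_le t η)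
  { toFun := fun A => LinearMap.mkContinuousOfExistsBound
      { toFun := fun η => ∫ t in (0 : ℝ)..T, A t (jet t η)
        map_add' := fun η ζ => by
          simp only [map_add, intervalIntegral.integral_add (hInt A η) (hInt A ζ)]
        map_smul' := fun c η => by
          simp only [map_smul, intervalIntegral.integral_smul, RingHom.id_apply] }
      (hbound A)
    map_add' := fun A A' => ContinuousLinearMap.ext fun η =>
      intervalIntegral.integral_add (hInt A η) (hInt A' η)
    map_smul' := fun c A => ContinuousLinearMap.ext fun η =>
      intervalIntegral.integral_smul c fun t => A t (jet t η) }

theorem firstVariation_apply (hT : 0 ≤ T) (A : C(ℝ, Eu n × Eu n →L[ℝ] ℝ)) (η : C1 T n) :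
    firstVariation hT A η = ∫ t in (0 : ℝ)..T, A t (jet t η) := rfl

theorem norm_firstVariation_le (hT : 0 ≤ T) {A : C(ℝ, Eu n × Eu n →L[ℝ] ℝ)} {C : ℝ}
    (hC : ∀ t ∈ Icc 0 T, ‖A t‖ ≤ C) :
    ‖(firstVariation hT A : C1 T n →L[ℝ] ℝ)‖ ≤ C * T := by
  have hC0 : 0 ≤ C := (norm_nonneg (A 0)).trans (hC 0 (left_mem_Icc.mpr hT))
  refine ContinuousLinearMap.opNorm_le_bound _ (mul_nonneg hC0 hT) fun η => ?_
  rw [mul_right_comm]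
  exact norm_integral_le_mul hT fun t ht =>
    (A t).le_of_opNorm_le_of_le (hC t ht) (norm_jet_le t η)

/-- The bilinear form `∫₀ᵀ a(t) (ξ, ξ') (η, η') dt`. -/
def secondVariation (hT : 0 ≤ T) (a : C(ℝ, Eu n × Eu n →L[ℝ] Eu n × Eu n →L[ℝ] ℝ)) :
    C1 T n →L[ℝ] C1 T n →L[ℝ] ℝ :=
  let along : C1 T n →ₗ[ℝ] C(ℝ, Eu n × Eu n →L[ℝ] ℝ) :=
    { toFun := fun ξ => ⟨fun t => a t (jet t ξ), a.continuous.clm_apply (continuous_jet ξ)⟩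
      map_add' := fun ξ ζ => ContinuousMap.ext fun t => by
        rw [ContinuousMap.coe_mk, map_add, map_add]; rfl
      map_smul' := fun c ξ => ContinuousMap.ext fun t => by
        rw [ContinuousMap.coe_mk, map_smul, map_smul]; rfl }
  LinearMap.mkContinuousOfExistsBound (firstVariation hT ∘ₗ along) (by
    obtain ⟨C, hC⟩ := (isCompact_Icc (a := 0) (b := T)).exists_bound_of_continuousOn
      (E := Eu n × Eu n →L[ℝ] Eu n × Eu n →L[ℝ] ℝ) a.continuous.continuousOn
    refine ⟨C * T, fun ξ => ?_⟩
    rw [mul_right_comm]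
    exact norm_firstVariation_le hT fun t ht =>
      (a t).le_of_opNorm_le_of_le (hC t ht) (norm_jet_le t ξ))

theorem secondVariation_apply (hT : 0 ≤ T) (a : C(ℝ, Eu n × Eu n →L[ℝ] Eu n × Eu n →L[ℝ] ℝ))
    (ξ η : C1 T n) :
    secondVariation hT a ξ η = ∫ t in (0 : ℝ)..T, a t (jet t ξ) (jet t η) := rfl

variable {G : ℝ → Eu n × Eu n → ℝ} {ρ : ℝ} {ξ : C1 T n}

theorem jet_mem_ball (hξ : ‖ξ‖ < ρ) (t : ℝ) : jet t ξ ∈ Metric.ball 0 ρ :=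
  mem_ball_zero_iff.mpr ((norm_jet_le t ξ).trans_lt hξ)

theorem eventually_norm_add_lt (hξ : ‖ξ‖ < ρ) : ∀ᶠ h in 𝓝 (0 : C1 T n), ‖ξ + h‖ < ρ :=
  (Continuous.tendsto' (by fun_prop) 0 ‖ξ‖ (by simp only [add_zero])).eventually_lt_const hξ

theorem continuous_fderiv_jet (hG : ∀ t, ∀ z ∈ Metric.ball 0 ρ, ContDiffSndAt 1 G (t, z))
    (hξ : ‖ξ‖ < ρ) : Continuous fun t => fderiv ℝ (G t) (jet t ξ) :=
  continuous_comp_of_contDiffSndAt (g := fun t z => fderiv ℝ (G t) z) (continuous_jet ξ)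
    fun t => (contDiffSndAt_succ.mp (hG t _ (jet_mem_ball hξ t))).2

theorem continuous_hessian_jet (hG : ∀ t, ∀ z ∈ Metric.ball 0 ρ, ContDiffSndAt 2 G (t, z))
    (hξ : ‖ξ‖ < ρ) : Continuous fun t => fderiv ℝ (fderiv ℝ (G t)) (jet t ξ) :=
  continuous_comp_of_contDiffSndAt (g := fun t z => fderiv ℝ (fderiv ℝ (G t)) z)
    (continuous_jet ξ) fun t => (contDiffSndAt_succ.mp (contDiffSndAt_succ.mp
      (hG t _ (jet_mem_ball hξ t))).2).2

theorem hasFDerivAt_integral_jet (hT : 0 < T)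
    (hG : ∀ t, ∀ z ∈ Metric.ball 0 ρ, ContDiffSndAt 1 G (t, z)) (hξ : ‖ξ‖ < ρ) :
    HasFDerivAt (fun ξ : C1 T n => ∫ t in (0 : ℝ)..T, G t (jet t ξ))
      (firstVariation hT.le ⟨_, continuous_fderiv_jet hG hξ⟩) ξ := by
  rw [hasFDerivAt_iff_isLittleO_nhds_zero, Asymptotics.isLittleO_iff]
  intro c hc
  obtain ⟨δ, hδ, htaylor⟩ := exists_forall_norm_taylor_sub_le (continuous_jet ξ)
    (fun t => hG t _ (jet_mem_ball hξ t)) (isCompact_Icc (a := 0) (b := T)) (div_pos hc hT)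
  have hcont : ∀ {ζ : C1 T n}, ‖ζ‖ < ρ → Continuous fun t => G t (jet t ζ) := fun {ζ} hζ =>
    continuous_comp_of_contDiffSndAt (continuous_jet ζ) fun t => hG t _ (jet_mem_ball hζ t)
  have hδnhds : ∀ᶠ h in 𝓝 (0 : C1 T n), ‖h‖ < δ :=
    (continuous_norm.tendsto' _ _ norm_zero).eventually_lt_const hδ
  filter_upwards [hδnhds, eventually_norm_add_lt hξ] with h hh hξh
  simp only [firstVariation_apply, ContinuousMap.coe_mk]
  rw [← intervalIntegral.integral_sub
    ((hcont hξh).intervalIntegrable _ _) ((hcont hξ).intervalIntegrable _ _),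
    ← intervalIntegral.integral_sub (((hcont hξh).fun_sub (hcont hξ)).intervalIntegrable _ _)
    (((continuous_fderiv_jet hG hξ).clm_apply (continuous_jet h)).intervalIntegrable _ _),
    show c * ‖h‖ = c / T * ‖h‖ * T by rw [mul_right_comm, div_mul_cancel₀ _ hT.ne']]
  refine norm_integral_le_mul hT.le fun t ht => ?_
  rw [map_add]
  refine (htaylor t ht (jet t h) ((norm_jet_le t h).trans_lt hh)).trans ?_
  gcongr
  exact norm_jet_le t h

theorem hasFDerivAt_fderiv_integral_jet (hT : 0 < T)
    (hG : ∀ t, ∀ z ∈ Metric.ball 0 ρ, ContDiffSndAt 2 G (t, z)) (hξ : ‖ξ‖ < ρ) :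
    HasFDerivAt (fderiv ℝ fun ξ : C1 T n => ∫ t in (0 : ℝ)..T, G t (jet t ξ))
      (secondVariation hT.le ⟨_, continuous_hessian_jet hG hξ⟩) ξ := by
  have hG' : ∀ t, ∀ z ∈ Metric.ball 0 ρ, ContDiffSndAt 1 G (t, z) :=
    fun t z hz => (hG t z hz).mono (by lia)
  rw [hasFDerivAt_iff_isLittleO_nhds_zero, Asymptotics.isLittleO_iff]
  intro c hc
  obtain ⟨δ, hδ, htaylor⟩ := exists_forall_norm_taylor_sub_le (g := fun t z => fderiv ℝ (G t) z)
    (continuous_jet ξ) (fun t => (contDiffSndAt_succ.mp (hG t _ (jet_mem_ball hξ t))).2)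
    (isCompact_Icc (a := 0) (b := T)) (div_pos hc hT)
  have hδnhds : ∀ᶠ h in 𝓝 (0 : C1 T n), ‖h‖ < δ :=
    (continuous_norm.tendsto' _ _ norm_zero).eventually_lt_const hδ
  filter_upwards [hδnhds, eventually_norm_add_lt hξ] with h hh hξh
  rw [(hasFDerivAt_integral_jet hT hG' hξh).fderiv, (hasFDerivAt_integral_jet hT hG' hξ).fderiv,
    show secondVariation hT.le ⟨_, continuous_hessian_jet hG hξ⟩ h = firstVariation hT.le
      ⟨_, (continuous_hessian_jet hG hξ).clm_apply (continuous_jet h)⟩ from rfl,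
    ← map_sub, ← map_sub,
    show c * ‖h‖ = c / T * ‖h‖ * T by rw [mul_right_comm, div_mul_cancel₀ _ hT.ne']]
  refine norm_firstVariation_le hT.le fun t ht => ?_
  change ‖fderiv ℝ (G t) (jet t (ξ + h)) - _ - _‖ ≤ _
  rw [map_add]
  refine (htaylor t ht (jet t h) ((norm_jet_le t h).trans_lt hh)).trans ?_
  gcongr
  exact norm_jet_le t h

end Functional

/-! ### The operator of the second variation -/

section HessianOperator

variable {T : ℝ} {n : ℕ} {a : C(ℝ, Eu n × Eu n →L[ℝ] Eu n × Eu n →L[ℝ] ℝ)}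

/-- The operator-valued function `A` with `A(t) v · w = a(t) (X v) (Y w)`: one of the four blocks
of the Hessian `a` when `X` and `Y` are inclusions of factors. -/
def block (a : C(ℝ, Eu n × Eu n →L[ℝ] Eu n × Eu n →L[ℝ] ℝ)) (X Y : Eu n →L[ℝ] Eu n × Eu n) :
    C(ℝ, Eu n →L[ℝ] Eu n) where
  toFun t := InnerProductSpace.continuousLinearMapOfBilin (𝕜 := ℝ) ((a t).bilinearComp X Y)
  continuous_toFun := continuous_clm_apply.mpr fun _ =>
    (InnerProductSpace.toDual ℝ (Eu n)).symm.continuous.comp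
      ((a.continuous.clm_apply continuous_const).clm_comp continuous_const)

theorem inner_block (X Y : Eu n →L[ℝ] Eu n × Eu n) (t : ℝ) (v w : Eu n) :
    inner ℝ (block a X Y t v) w = a t (X v) (Y w) :=
  InnerProductSpace.continuousLinearMapOfBilin_apply (𝕜 := ℝ) _ v w

theorem inner_block_comm (hsymm : ∀ t z w, a t z w = a t w z) (X Y : Eu n →L[ℝ] Eu n × Eu n)
    (t : ℝ) (v w : Eu n) : inner ℝ (block a X Y t v) w = inner ℝ v (block a Y X t w) := by
  rw [real_inner_comm _ v, inner_block, inner_block, hsymm]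

theorem periodic_block (hper : Periodic a T) (X Y : Eu n →L[ℝ] Eu n × Eu n) :
    Periodic (block a X Y) T := fun t =>
  congrArg (fun b : Eu n × Eu n →L[ℝ] Eu n × Eu n →L[ℝ] ℝ =>
    InnerProductSpace.continuousLinearMapOfBilin (𝕜 := ℝ) (b.bilinearComp X Y)) (hper t)

/-- The operator on `W^{1,2}` that represents the bilinear form `∫₀ᵀ a(t) (ξ, ξ') (η, η') dt`. -/
def hessianOp (T : ℝ) (a : C(ℝ, Eu n × Eu n →L[ℝ] Eu n × Eu n →L[ℝ] ℝ)) :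
    W12 T n →L[ℝ] W12 T n :=
  formOp T (block a (.inr ℝ _ _) (.inr ℝ _ _)) (block a (.inl ℝ _ _) (.inr ℝ _ _))
    (block a (.inr ℝ _ _) (.inl ℝ _ _)) (block a (.inl ℝ _ _) (.inl ℝ _ _))

theorem secondVariation_eq_inner_hessianOp (hT : 0 ≤ T) (ξ η : C1 T n) :
    secondVariation hT a ξ η = inner ℝ (hessianOp T a (incl T n ξ)) (incl T n η) := by
  have hInt : ∀ (X Y : Eu n →L[ℝ] Eu n × Eu n) (u v : ℝ →ᵇ Eu n),
      Integrable (fun t => inner ℝ (block a X Y t (u t)) (v t)) (perMeas T) := fun X Y u v =>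
    (((block a X Y).continuous.clm_apply u.continuous).inner v.continuous).integrableOn_Ioc
  have hjet : ∀ (t : ℝ) (ζ : C1 T n), jet t ζ =
      ContinuousLinearMap.inr ℝ (Eu n) (Eu n) (ζ.1.2 t) +
        ContinuousLinearMap.inl ℝ (Eu n) (Eu n) (ζ.1.1 t) := fun t ζ =>
    Prod.ext (zero_add _).symm (add_zero _).symm
  rw [hessianOp, inner_formOp, inner_add_left, inner_add_left,
    inner_mulOp_eq_integral _ (coeFn_derivL_incl ξ) (coeFn_derivL_incl η),
    inner_mulOp_eq_integral _ (coeFn_valL_incl ξ) (coeFn_derivL_incl η),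
    inner_mulOp_eq_integral _ (coeFn_derivL_incl ξ) (coeFn_valL_incl η),
    inner_mulOp_eq_integral _ (coeFn_valL_incl ξ) (coeFn_valL_incl η),
    ← integral_add (hInt _ _ _ _) (hInt _ _ _ _), ← integral_add (hInt _ _ _ _) (hInt _ _ _ _),
    ← integral_add ((hInt _ _ _ _).fun_add (hInt _ _ _ _))
      ((hInt _ _ _ _).fun_add (hInt _ _ _ _)),
    secondVariation_apply, intervalIntegral.integral_of_le hT]
  refine integral_congr_ae (Eventually.of_forall fun t => ?_)
  simp only [inner_block, hjet, map_add, add_apply]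

theorem isSelfAdjoint_hessianOp (hsymm : ∀ t z w, a t z w = a t w z) :
    IsSelfAdjoint (hessianOp T a) :=
  isSelfAdjoint_formOp (inner_block_comm hsymm _ _) (inner_block_comm hsymm _ _)
    (inner_block_comm hsymm _ _)

theorem inner_block_inr_pos (hpos : ∀ t v, v ≠ 0 → 0 < a t (0, v) (0, v)) (t : ℝ) (v : Eu n)
    (hv : v ≠ 0) : 0 < inner ℝ (block a (.inr ℝ _ _) (.inr ℝ _ _) t v) v := by
  rw [inner_block]
  exact hpos t v hv

theorem isEssentiallyCoercive_hessianOp (hT : 0 < T)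
    (hpos : ∀ t v, v ≠ 0 → 0 < a t (0, v) (0, v)) : IsEssentiallyCoercive (hessianOp T a) := by
  obtain ⟨p, hp, hle⟩ := exists_pos_forall_mul_norm_sq_le_inner (isCompact_Icc (a := 0) (b := T))
    (block a (.inr ℝ _ _) (.inr ℝ _ _)).continuous (inner_block_inr_pos hpos)
  exact isEssentiallyCoercive_formOp hT _ _ _ hp hle

theorem mem_range_incl_of_hessianOp_mem (hT : 0 < T) (hper : Periodic a T)
    (hpos : ∀ t v, v ≠ 0 → 0 < a t (0, v) (0, v)) {ξ : W12 T n}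
    (hξ : hessianOp T a ξ ∈ LinearMap.range (incl T n)) : ξ ∈ LinearMap.range (incl T n) := by
  obtain ⟨g, hg⟩ := hξ
  exact mem_range_incl_of_formOp_eq_incl hT (periodic_block hper _ _) (periodic_block hper _ _)
    (fun t => isUnit_of_inner_pos (inner_block_inr_pos hpos t)) hg.symm

theorem negEigenspan_hessianOp_le_range_incl (hT : 0 < T) (hper : Periodic a T)
    (hpos : ∀ t v, v ≠ 0 → 0 < a t (0, v) (0, v)) :
    negEigenspan (hessianOp T a) ≤ LinearMap.range (incl T n) :=
  negEigenspan_formOp_le_range_incl hT (periodic_block hper _ _) (periodic_block hper _ _)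
    (inner_block_inr_pos hpos)

theorem RepresentsHessian.eq (hT : 0 < T) {f : C1 T n → ℝ} {B B' : W12 T n →L[ℝ] W12 T n}
    (hB : RepresentsHessian f B) (hB' : RepresentsHessian f B') : B = B' := by
  obtain ⟨-, D, hD, hBD⟩ := hB
  obtain ⟨-, D', hD', hBD'⟩ := hB'
  obtain rfl := hD.unique hD'
  have hdense := denseRange_incl (n := n) hT
  refine ContinuousLinearMap.coeFn_injective
    (hdense.equalizer B.continuous B'.continuous (funext fun ξ => ext_inner_right ℝ ?_))
  exact congrFun (hdense.equalizer (by fun_prop) (by fun_prop)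
    (funext fun η => (hBD ξ η).symm.trans (hBD' ξ η)))

end HessianOperator

/-! ### The Hessian of the pulled-back Lagrangian -/

theorem iteratedDeriv_two_line {E : Type*} [NormedAddCommGroup E] [NormedSpace ℝ E] {f : E → ℝ}
    {x : E} (hf : ContDiffAt ℝ 2 f x) (v : E) :
    iteratedDeriv 2 (fun s : ℝ => f (x + s • v)) 0 = fderiv ℝ (fderiv ℝ f) x v v := by
  have hline : ∀ s : ℝ, HasDerivAt (fun s : ℝ => x + s • v) v s := fun s => by
    simpa only [one_smul, id_eq] using ((hasDerivAt_id s).smul_const v).const_add x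
  have hx : x = x + (0 : ℝ) • v := by rw [zero_smul, add_zero]
  have hfirst : deriv (fun s : ℝ => f (x + s • v)) =ᶠ[𝓝 0] fun s => fderiv ℝ f (x + s • v) v := by
    have hnear : ∀ᶠ y in 𝓝 (x + (0 : ℝ) • v), ContDiffAt ℝ 2 f y :=
      hx ▸ hf.eventually (by simp)
    filter_upwards [(hline 0).continuousAt.eventually hnear] with s hs
    exact ((hs.differentiableAt (by simp)).hasFDerivAt.comp_hasDerivAt s (hline s)).deriv
  have hsecond : HasFDerivAt (fderiv ℝ f) (fderiv ℝ (fderiv ℝ f) x) x :=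
    ((hf.fderiv_right (m := 1) one_add_one_eq_two.le).differentiableAt (by simp)).hasFDerivAt
  rw [iteratedDeriv_succ, iteratedDeriv_one, hfirst.deriv_eq]
  exact ((ContinuousLinearMap.apply ℝ ℝ v).hasFDerivAt.comp_hasDerivAt 0
    (hsecond.comp_hasDerivAt_of_eq 0 (hline 0) hx)).deriv

section JetLagrangian

variable {n : ℕ} {M : Type*} [TopologicalSpace M] [ChartedSpace (Eu n) M]
  {E : Type} [NormedAddCommGroup E] [NormedSpace ℝ E]
  {L : ℝ × TangentBundle (𝓡 n) M → ℝ} {T ρ : ℝ} {r s : ℕ} {f : ℝ → E → M} {U : Set E}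
  {γ : ℝ → M} {φ : ℝ → Eu n → M}

/-- The pulled-back Lagrangian, as a function of the time and the 1-jet. -/
def jetLagrangian (L : ℝ × TangentBundle (𝓡 n) M → ℝ) (f : ℝ → E → M) (t : ℝ) (z : E × E) : ℝ :=
  L (t, velocity n f t z)

theorem pulledAction_eq_integral_jetLagrangian [IsManifold (𝓡 n) 1 M] :
    (pulledAction T L φ : C1 T n → ℝ) =
      fun ξ => ∫ t in (0 : ℝ)..T, jetLagrangian L φ t (jet t ξ) := rfl

theorem fderiv_fderiv_jetLagrangian_add_period (hL : ∀ t z, L (t + T, z) = L (t, z))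
    (hf : IsFamily n r s f U) (hU : IsOpen U) (hr : 1 ≤ r)
    (hper : ∀ t, ∀ q ∈ U, f (t + T) q = f t q) {z : E × E} (hz : z.1 ∈ U) (t : ℝ) :
    fderiv ℝ (fderiv ℝ (jetLagrangian L f (t + T))) z =
      fderiv ℝ (fderiv ℝ (jetLagrangian L f t)) z := by
  have hlocal : jetLagrangian L f (t + T) =ᶠ[𝓝 z] jetLagrangian L f t := by
    filter_upwards [continuousAt_fst.eventually (hU.mem_nhds hz)] with w hw
    rw [jetLagrangian, velocity_add_period hf hU hr hper hw, hL, jetLagrangian]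
  exact hlocal.fderiv.fderiv_eq

theorem fderiv_fderiv_jetLagrangian_pos (hconv : FibrewiseConvex L)
    (hf : IsFamily n r s f U) (hU : IsOpen U) (hr : 1 ≤ r) {t : ℝ} {z : E × E} (hz : z.1 ∈ U)
    (hinj : Injective (mfderiv 𝓘(ℝ, E) (𝓡 n) (f t) z.1))
    (hG : ContDiffAt ℝ 2 (jetLagrangian L f t) z) {v : E} (hv : v ≠ 0) :
    0 < fderiv ℝ (fderiv ℝ (jetLagrangian L f t)) z (0, v) (0, v) := by
  set A : ℝ × E →L[ℝ] Eu n := mfderiv 𝓘(ℝ, ℝ × E) (𝓡 n) (uncurry f) (t, z.1)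
  have hA : A (0, v) ≠ 0 := by
    rw [← show mfderiv 𝓘(ℝ, E) (𝓡 n) (f t) z.1 v = A (0, v) from mfderiv_slice hf hU hr hz t v]
    exact fun h => hv (hinj (h.trans (map_zero _).symm))
  have hline : (fun τ : ℝ => jetLagrangian L f t (z + τ • ((0, v) : E × E))) =
      fun τ : ℝ => L (t, ⟨f t z.1, A (1, z.2) + τ • A (0, v)⟩) := by
    funext τ
    have hz' : z + τ • ((0, v) : E × E) = (z.1, z.2 + τ • v) := by ext <;> simp
    have hAv : A (1, z.2) + τ • A (0, v) = A (1, z.2 + τ • v) := by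
      rw [← map_smul, ← map_add]
      simp
    rw [hz', hAv]
    rfl
  rw [← iteratedDeriv_two_line hG, hline]
  exact hconv t (f t z.1) (A (1, z.2)) (A (0, v)) hA

theorem contDiffSndAt_jetLagrangian [IsManifold (𝓡 n) 1 M]
    (hL : ContMDiff (𝓘(ℝ, ℝ).prod (𝓡 n).tangent) 𝓘(ℝ, ℝ) 2 L)
    (hφ : IsLoopChart T ρ γ φ) (t : ℝ) {z : Eu n × Eu n} (hz : z ∈ Metric.ball 0 ρ) :
    ContDiffSndAt 2 (jetLagrangian L φ) (t, z) :=
  contDiffSndAt_comp_velocity hL hφ.regular Metric.isOpen_ball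
    (mem_ball_zero_iff.mpr ((norm_fst_le z).trans_lt (mem_ball_zero_iff.mp hz))) t z.2

theorem exists_representsHessian_hessianOp [IsManifold (𝓡 n) 1 M] (hT : 0 < T)
    (hL : ContMDiff (𝓘(ℝ, ℝ).prod (𝓡 n).tangent) 𝓘(ℝ, ℝ) 2 L)
    (hper : ∀ t z, L (t + T, z) = L (t, z)) (hconv : FibrewiseConvex L)
    (hρ : 0 < ρ) (hφ : IsLoopChart T ρ γ φ) :
    ∃ a : C(ℝ, Eu n × Eu n →L[ℝ] Eu n × Eu n →L[ℝ] ℝ), (∀ t z w, a t z w = a t w z) ∧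
      Periodic a T ∧ (∀ t v, v ≠ 0 → 0 < a t (0, v) (0, v)) ∧
      RepresentsHessian (pulledAction T L φ) (hessianOp T a) := by
  have hG : ∀ t, ∀ z ∈ Metric.ball 0 ρ, ContDiffSndAt 2 (jetLagrangian L φ) (t, z) :=
    fun t z => contDiffSndAt_jetLagrangian hL hφ t
  have hG₀ : ∀ t, ContDiffAt ℝ 2 (jetLagrangian L φ t) 0 := fun t =>
    (hG t 0 (Metric.mem_ball_self hρ)).self_of_nhds.1
  have h0 : (0 : Eu n) ∈ Metric.ball 0 ρ := Metric.mem_ball_self hρ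
  have hξ₀ : ‖(0 : C1 T n)‖ < ρ := by rwa [norm_zero]
  have hcont : Continuous fun t => fderiv ℝ (fderiv ℝ (jetLagrangian L φ t)) 0 := by
    simpa only [map_zero] using continuous_hessian_jet hG hξ₀
  have hsecond : HasFDerivAt (fderiv ℝ (pulledAction T L φ))
      (secondVariation hT.le ⟨_, hcont⟩) (0 : C1 T n) := by
    rw [pulledAction_eq_integral_jetLagrangian]
    simpa only [map_zero] using hasFDerivAt_fderiv_integral_jet hT hG hξ₀
  refine ⟨⟨_, hcont⟩, fun t => ((hG₀ t).isSymmSndFDerivAt (by simp)).eq, fun t => ?_,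
    fun t v hv => ?_, ?_, _, hsecond, secondVariation_eq_inner_hessianOp hT.le⟩
  · exact fderiv_fderiv_jetLagrangian_add_period (z := 0) hper hφ.regular Metric.isOpen_ball
      (by lia) hφ.periodic h0 t
  · exact fderiv_fderiv_jetLagrangian_pos (z := 0) hconv hφ.regular Metric.isOpen_ball (by lia)
      h0 (hφ.immersion t 0 h0) (hG₀ t) hv
  · filter_upwards [Metric.ball_mem_nhds (0 : C1 T n) hρ] with ξ hξ
    exact (hasFDerivAt_integral_jet hT (fun t z hz => (hG t z hz).mono one_le_two)
      (mem_ball_zero_iff.mp hξ)).differentiableAt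

theorem hasDerivAt_pulledAction_smul [IsManifold (𝓡 n) 1 M] (hρ : 0 < ρ)
    (hγ : IsCriticalLoop T L γ) (hφ : IsLoopChart T ρ γ φ) (η : C1 T n) :
    HasDerivAt (fun s : ℝ => pulledAction T L φ (s • η)) 0 0 := by
  have hsmall : ∀ᶠ s in 𝓝 (0 : ℝ), ‖s • η‖ < ρ :=
    (Continuous.tendsto' (by fun_prop) 0 0 (by rw [zero_smul, norm_zero])).eventually_lt_const hρ
  obtain ⟨ε, hε, hball⟩ := Metric.eventually_nhds_iff_ball.mp hsmall
  have hmem : ∀ s ∈ Metric.ball (0 : ℝ) ε, ∀ t, s • η.1.1 t ∈ Metric.ball (0 : Eu n) ρ :=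
    fun s hs t => mem_ball_zero_iff.mpr
      ((norm_fst_le (jet t (s • η))).trans_lt ((norm_jet_le t _).trans_lt (hball s hs)))
  refine (hγ.2.2 ε (fun t s => φ t (s • η.1.1 t)) hε
    ((isFamily_smul_loop hφ.regular η hmem).mono (by lia) (by lia)) (fun t s hs => ?_)
    (fun t => by rw [zero_smul, hφ.center])).congr_of_eventuallyEq ?_
  · rw [η.2.1 t]
    exact hφ.periodic t _ (hmem s hs t)
  · filter_upwards [Metric.ball_mem_nhds (0 : ℝ) hε] with s hs
    exact (action_eq_pulledAction hφ.regular Metric.isOpen_ball (by lia) (s • η) (hmem s hs)).symm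

theorem hasFDerivAt_pulledAction_zero [IsManifold (𝓡 n) 1 M] (hρ : 0 < ρ)
    (hγ : IsCriticalLoop T L γ) (hφ : IsLoopChart T ρ γ φ)
    (hdiff : DifferentiableAt ℝ (pulledAction T L φ) (0 : C1 T n)) :
    HasFDerivAt (pulledAction T L φ) (0 : C1 T n →L[ℝ] ℝ) 0 := by
  suffices hzero : fderiv ℝ (pulledAction T L φ) (0 : C1 T n) = 0 from hzero ▸ hdiff.hasFDerivAt
  refine ContinuousLinearMap.ext fun η => ?_
  have hline : HasDerivAt (fun s : ℝ => s • η) η 0 := by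
    simpa only [one_smul, id_eq] using (hasDerivAt_id (0 : ℝ)).smul_const η
  exact (hdiff.hasFDerivAt.comp_hasDerivAt_of_eq 0 hline (zero_smul ℝ η).symm).unique
    (hasDerivAt_pulledAction_smul hρ hγ hφ η)

end JetLagrangian

end Loop

end

theorem lemma2p4_general {n : ℕ} {M : Type*} [TopologicalSpace M] [ChartedSpace (Loop.Eu n) M]
    [IsManifold (𝓡 n) 1 M] {T : ℝ} (hT : 0 < T) {L : ℝ × TangentBundle (𝓡 n) M → ℝ}
    (hL : ContMDiff (𝓘(ℝ, ℝ).prod (𝓡 n).tangent) 𝓘(ℝ, ℝ) 2 L)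
    (hper : ∀ t z, L (t + T, z) = L (t, z)) (hconv : Loop.FibrewiseConvex L)
    {γ₀ : ℝ → M} (hγ₀ : Loop.IsCriticalLoop T L γ₀)
    {ρ : ℝ} (hρ : 0 < ρ) {φ : ℝ → Loop.Eu n → M} (hφ : Loop.IsLoopChart T ρ γ₀ φ) :
    (∃! B : Loop.W12 T n →L[ℝ] Loop.W12 T n,
      Loop.RepresentsHessian (Loop.pulledAction T L φ) B) ∧
    ∀ B : Loop.W12 T n →L[ℝ] Loop.W12 T n,
      Loop.RepresentsHessian (Loop.pulledAction T L φ) B →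
      IsSelfAdjoint B ∧
      HasFDerivAt (Loop.pulledAction T L φ) (0 : Loop.C1 T n →L[ℝ] ℝ) 0 ∧
      ((0 : ℝ) ∉ spectrum ℝ B ∨ ∃ ε > 0, spectrum ℝ B ∩ Metric.ball 0 ε = {0}) ∧
      (∀ ξ : Loop.W12 T n, B ξ ∈ LinearMap.range (Loop.incl T n) →
        ξ ∈ LinearMap.range (Loop.incl T n)) ∧
      ∃ V : Submodule ℝ (Loop.W12 T n),
        Loop.IsNegativeSpace B V ∧
        (∀ V' : Submodule ℝ (Loop.W12 T n), Loop.IsNegativeSpace B V' → V' = V) ∧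
        FiniteDimensional ℝ V ∧
        V ≤ LinearMap.range (Loop.incl T n) ∧
        ∀ S : Submodule ℝ (Loop.W12 T n),
          (∀ v ∈ S, v ≠ 0 → inner ℝ (B v) v < 0) →
          FiniteDimensional ℝ S ∧ Module.finrank ℝ S ≤ Module.finrank ℝ V := by
  obtain ⟨a, hsymm, haper, hapos, hrep⟩ :=
    Loop.exists_representsHessian_hessianOp hT hL hper hconv hρ hφ
  refine ⟨⟨_, hrep, fun B hB => hB.eq hT hrep⟩, fun B hB => ?_⟩
  obtain rfl := hB.eq hT hrep
  have hsa := Loop.isSelfAdjoint_hessianOp (T := T) hsymm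
  have hcoer := Loop.isEssentiallyCoercive_hessianOp hT hapos
  have hneg := hcoer.isNegativeSpace_negEigenspan hsa
  have hfin := hcoer.finiteDimensional_negEigenspan hsa
  exact ⟨hsa, Loop.hasFDerivAt_pulledAction_zero hρ hγ₀ hφ hrep.1.self_of_nhds,
    hcoer.zero_notMem_spectrum_or_isolated hsa,
    fun ξ => Loop.mem_range_incl_of_hessianOp_mem hT haper hapos,
    Loop.negEigenspan (Loop.hessianOp T a), hneg, fun V' => hneg.eq_negEigenspan hsa, hfin,
    Loop.negEigenspan_hessianOp_le_range_incl hT haper hapos,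
    fun S => Loop.finrank_le_of_neg_of_nonneg hneg.nonneg⟩

theorem lemma2p4 {n : ℕ} {M : Type*} [TopologicalSpace M] [T2Space M] [CompactSpace M]
    [ChartedSpace (Loop.Eu n) M] [IsManifold (𝓡 n) 3 M]
    (k : ℕ) (hk : 0 < k) (τ : ℝ) (hτ : 0 < τ)
    (L : ℝ × TangentBundle (𝓡 n) M → ℝ)
    (hL : ContMDiff (𝓘(ℝ, ℝ).prod (𝓡 n).tangent) 𝓘(ℝ, ℝ) 2 L)
    (hper : ∀ t z, L (t + τ, z) = L (t, z))
    (hconv : Loop.FibrewiseConvex L)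
    (γ₀ : ℝ → M) (hγ₀ : Loop.IsCriticalLoop (k * τ) L γ₀)
    (ρ : ℝ) (hρ : 0 < ρ) (φ : ℝ → Loop.Eu n → M) (hφ : Loop.IsLoopChart (k * τ) ρ γ₀ φ) :
    (∃! B : Loop.W12 (k * τ) n →L[ℝ] Loop.W12 (k * τ) n,
      Loop.RepresentsHessian (Loop.pulledAction (k * τ) L φ) B) ∧
    ∀ B : Loop.W12 (k * τ) n →L[ℝ] Loop.W12 (k * τ) n,
      Loop.RepresentsHessian (Loop.pulledAction (k * τ) L φ) B →
      IsSelfAdjoint B ∧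
      HasFDerivAt (Loop.pulledAction (k * τ) L φ) (0 : Loop.C1 (k * τ) n →L[ℝ] ℝ) 0 ∧
      ((0 : ℝ) ∉ spectrum ℝ B ∨ ∃ ε > 0, spectrum ℝ B ∩ Metric.ball 0 ε = {0}) ∧
      (∀ ξ : Loop.W12 (k * τ) n, B ξ ∈ LinearMap.range (Loop.incl (k * τ) n) →
        ξ ∈ LinearMap.range (Loop.incl (k * τ) n)) ∧
      ∃ V : Submodule ℝ (Loop.W12 (k * τ) n),
        Loop.IsNegativeSpace B V ∧
        (∀ V' : Submodule ℝ (Loop.W12 (k * τ) n), Loop.IsNegativeSpace B V' → V' = V) ∧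
        FiniteDimensional ℝ V ∧
        V ≤ LinearMap.range (Loop.incl (k * τ) n) ∧
        ∀ S : Submodule ℝ (Loop.W12 (k * τ) n),
          (∀ v ∈ S, v ≠ 0 → inner ℝ (B v) v < 0) →
          FiniteDimensional ℝ S ∧ Module.finrank ℝ S ≤ Module.finrank ℝ V := by
  have hT : 0 < (k : ℝ) * τ := mul_pos (Nat.cast_pos.mpr hk) hτ
  exact lemma2p4_general hT hL
    (fun t z => Function.Periodic.nat_mul (f := fun t => L (t, z)) (fun t => hper t z) k t)
    hconv hγ₀ hρ hφ
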